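/- Let $d\in\{2,3\}$, let $k\ge 1$ be an integer and let $\mu>0$. Let $\Omega\subset\mathbb R^d$ be an open, bounded, connected domain with Lipschitz continuous boundary, and let $\mathcal T_h$ be a finite partition of $\Omega$ into polygons ($d=2$) or polyhedra ($d=3$) with flat sides (edges, resp. faces), every side being contained in $\partial\Omega$ or common to two elements. Write $h_T$, $h_e$ for the diameters of an element $T$ and of a side $e$, and $\mathbf n$ for the unit outward normal on $\partial T$. Assume that $\mathcal T_h$ is shape regular, i.e. that there are fixed positive constants $\varrho_v,\varrho_e,\kappa,\sigma_*,\gamma_*,\tau$, an angle $\theta_0\in[0,\pi/2)$ and an integer $m$ such that, for every element $T$ and every side $e$ of $T$: (A1) $\varrho_v h_T^d\le |T|$ and $\varrho_e h_e^{d-1}\le |e|$; (A2) $\kappa h_T\le h_e$; (A3) there is a pyramid contained in $T$ with base $e$, apex $A_e\in T$ and height $\sigma_e h_T$, $\sigma_e\ge\sigma_*$, such that for each $x_e\in e$ the angle between $x_e-A_e$ and the outward normal of $e$ is at most $\theta_0$; (A4) $T$ is contained in a simplex $S(T)$ which contains a ball of radius $\tau\,\mathrm{diam}\,S(T)$, with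 $\mathrm{diam}\,S(T)\le\gamma_* h_T$, and $S(T)$ meets at most $m$ of the simplices $S(T')$, $T'\ne T$. For a side $e$ let $V_{k-1}(e)=[P_{k-1}(e)]^d+P_{RM}(e)$, where $P_{RM}(e)$ consists of the restrictions to $e$ of the rigid motions $a+\eta x$, $a\in\mathbb R^d$, $\eta\in\mathbb R^{d\times d}$ skew-symmetric, and let $Q_b$ be the $L^2(e)$-projection onto $V_{k-1}(e)$ on each side $e$. Let $V_h$ be the space of pairs $v=\{v_0,v_b\}$ with $v_0|_T\in[P_k(T)]^d$ for each element $T$ and $v_b|_e\in V_{k-1}(e)$ (single-valued) for each side $e$, and let $V_h^0=\{v\in V_h: v_b=0\text{ on }\partial\Omega\}$. For $v\in V_h$ the discrete weak gradient $\nabla_w v$ is, on each element $T$, the unique element of $[P_{k-1}(T)]^{d\times d}$ with $$(\nabla_w v,\varphi)_T=-(v_0,\nabla\cdot\varphi)_T+\langle v_b,\varphi\mathbf n\rangle_{\partial T}\qquad\forall \varphi\in[P_{k-1}(T)]^{d\times d},$$ where $\nabla\cdot$ acts on rows. Put $\varepsilon_w(v)=\frac12(\nabla_w v+(\nabla_w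 v)^T)$, $\varepsilon(v_0)=\frac12(\nabla v_0+(\nabla v_0)^T)$, $$a(w,v)=2\sum_{T\in\mathcal T_h}(\mu\,\varepsilon_w(w),\varepsilon_w(v))_T+\sum_{T\in\mathcal T_h}h_T^{-1}\langle Q_bw_0-w_b,\,Q_bv_0-v_b\rangle_{\partial T},$$ $$|||v|||=\Big(\sum_{T\in\mathcal T_h}\|\varepsilon(v_0)\|_T^2+h_T^{-1}\|Q_bv_0-v_b\|_{\partial T}^2\Big)^{1/2}.$$ Then there exist positive constants $\alpha_1$ and $\alpha_2$, depending only on $d$, $k$, $\mu$, the shape regularity constants above and an upper bound for the number of sides of an element (in particular not on the mesh size), such that $$\alpha_1|||v|||^2\le a(v,v)\le\alpha_2|||v|||^2\qquad\forall\,v\in V_h^0.$$ -/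

import Mathlib

open MeasureTheory
open scoped NNReal Matrix

noncomputable section

namespace WG

/-- `ℝ^d` with the Euclidean norm. -/
abbrev Euc (d : ℕ) := EuclideanSpace ℝ (Fin d)

/-! ### Domains and partitions -/

/-- `Ω` has a Lipschitz boundary: near each boundary point, `Ω` is the region on one side of the
graph of a Lipschitz function, in the direction of some unit vector `ν`. -/
def HasLipschitzBoundary {d : ℕ} (Ω : Set (Euc d)) : Prop :=
  ∀ x ∈ frontier Ω, ∃ (ν : Euc d) (U : Set (Euc d)) (γ : Euc d → ℝ) (K : ℝ≥0),
    ‖ν‖ = 1 ∧ IsOpen U ∧ x ∈ U ∧ LipschitzWith K γ ∧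
      ∀ y ∈ U, (y ∈ Ω ↔ inner ℝ ν y < γ (y - (inner ℝ ν y) • ν))

/-- A (not necessarily convex) `m`-dimensional polytope in `ℝ^d`: a compact set spanning an
`m`-dimensional affine subspace, which is the closure of its (connected) interior relative to this
subspace and whose relative boundary is contained in finitely many proper affine subspaces of it.
For `m = 1, 2, 3` these are the segments, the flat polygons and the polyhedra. -/
structure IsPolytope {d : ℕ} (m : ℕ) (s : Set (Euc d)) : Prop where
  compact : IsCompact s
  dim : Module.finrank ℝ (affineSpan ℝ s).direction = m
  connected : IsConnected (intrinsicInterior ℝ s)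
  regular : s ⊆ closure (intrinsicInterior ℝ s)
  flat : ∃ F : Finset (AffineSubspace ℝ (Euc d)),
    (∀ Q ∈ F, Q < affineSpan ℝ s) ∧ intrinsicFrontier ℝ s ⊆ ⋃ Q ∈ F, (Q : Set (Euc d))

/-- `n` is the unit normal vector to the flat side `e` of `T`, pointing out of `T`. -/
def IsOutwardNormal {d : ℕ} (T e : Set (Euc d)) (n : Euc d) : Prop :=
  ‖n‖ = 1 ∧ (∀ x ∈ e, ∀ y ∈ e, inner ℝ n (y - x) = 0) ∧
    ∀ x ∈ intrinsicInterior ℝ e, ∃ δ : ℝ, 0 < δ ∧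
      ∀ s : ℝ, 0 < s → s < δ → x - s • n ∈ T ∧ x + s • n ∉ T

/-- The unit outward normal vector to `T` on its side `e`. -/
def outwardNormal {d : ℕ} (T e : Set (Euc d)) : Euc d :=
  Classical.epsilon (IsOutwardNormal T e)

/-- A finite collection of elements, together with the collection of their sides
(edges for `d = 2`, faces for `d = 3`). -/
structure Mesh (d : ℕ) where
  elements : Finset (Set (Euc d))
  sides : Finset (Set (Euc d))

open Classical in
/-- The sides of the element `T`: those which lie on its boundary. -/
def Mesh.sidesOf {d : ℕ} (M : Mesh d) (T : Set (Euc d)) : Finset (Set (Euc d)) :=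
  M.sides.filter (fun e => e ⊆ frontier T)

/-- `M` is a finite element partition of the domain `Ω` into polygons (`d = 2`) or polyhedra
(`d = 3`). Two elements may share only part of a geometric facet; this facet is then subdivided
into several sides, so that every side is either on the boundary of `Ω` or common to two elements
(this is forced by `frontier_eq` and `sides_disjoint`). -/
structure Mesh.IsPartition {d : ℕ} (M : Mesh d) (Ω : Set (Euc d)) : Prop where
  elements_polytope : ∀ T ∈ M.elements, IsPolytope d T
  sides_polytope : ∀ e ∈ M.sides, IsPolytope (d - 1) e
  covers : ⋃ T ∈ M.elements, T = closure Ω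
  interiors_disjoint : ∀ T ∈ M.elements, ∀ T' ∈ M.elements, T ≠ T' →
    Disjoint (interior T) (interior T')
  sides_disjoint : ∀ e ∈ M.sides, ∀ e' ∈ M.sides, e ≠ e' →
    Disjoint (intrinsicInterior ℝ e) (intrinsicInterior ℝ e')
  side_of_element : ∀ e ∈ M.sides, ∃ T ∈ M.elements, e ∈ M.sidesOf T
  frontier_eq : ∀ T ∈ M.elements, frontier T = ⋃ e ∈ M.sidesOf T, e
  exists_normal : ∀ T ∈ M.elements, ∀ e ∈ M.sidesOf T, ∃ n, IsOutwardNormal T e n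

/-! ### Shape regularity -/

/-- The diameter `h_s` of an element or a side. -/
abbrev size {d : ℕ} (s : Set (Euc d)) : ℝ := Metric.diam s

/-- The area (`d = 3`) or length (`d = 2`) measure on sides: the `(d-1)`-dimensional Hausdorff
measure, normalized to agree with Lebesgue measure on hyperplanes. -/
abbrev surf (d : ℕ) : Measure (Euc d) := Measure.euclideanHausdorffMeasure (d - 1)

/-- The constants that quantify shape regularity. -/
structure ShapeConstants where
  /-- lower bound for `|T| / h_T ^ d` -/
  rhoV : ℝ
  /-- lower bound for `|e| / h_e ^ (d - 1)` -/
  rhoE : ℝ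
  /-- lower bound for `h_e / h_T` -/
  kappa : ℝ
  /-- lower bound for the relative height of the pyramids -/
  sigma : ℝ
  /-- upper bound for the angle of the pyramids with the normal -/
  theta : ℝ
  /-- upper bound for the relative diameter of the circumscribed simplices -/
  gamma : ℝ
  /-- lower bound for the ratio of inradius and diameter of the circumscribed simplices -/
  tau : ℝ
  /-- upper bound for the number of simplices that meet a given one -/
  overlap : ℕ
  rhoV_pos : 0 < rhoV
  rhoE_pos : 0 < rhoE
  kappa_pos : 0 < kappa
  sigma_pos : 0 < sigma
  theta_nonneg : 0 ≤ theta
  theta_lt : theta < Real.pi / 2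
  gamma_pos : 0 < gamma
  tau_pos : 0 < tau

open Classical in
/-- Shape regularity of a polygonal or polyhedral partition. -/
structure Mesh.ShapeRegular {d : ℕ} (M : Mesh d) (c : ShapeConstants) : Prop where
  volume_ge : ∀ T ∈ M.elements, c.rhoV * size T ^ d ≤ volume.real T
  area_ge : ∀ e ∈ M.sides, c.rhoE * size e ^ (d - 1) ≤ (surf d).real e
  size_ge : ∀ T ∈ M.elements, ∀ e ∈ M.sidesOf T, c.kappa * size T ≤ size e
  /-- Each side `e` of `T` is the base of a pyramid contained in `T`, with apex `A` and with height
  `σ h_T`, `σ ≥ σ_*`, that stands up above its base. -/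
  pyramid : ∀ T ∈ M.elements, ∀ e ∈ M.sidesOf T, ∃ A ∈ T, ∃ σ : ℝ, c.sigma ≤ σ ∧
    convexJoin ℝ {A} e ⊆ T ∧
    ∀ x ∈ e, inner ℝ (outwardNormal T e) (x - A) = σ * size T ∧
      InnerProductGeometry.angle (x - A) (outwardNormal T e) ≤ c.theta
  /-- Each `T` has a shape regular circumscribed simplex `S T` of comparable diameter, and each of
  these simplices meets only a fixed number of others. -/
  simplex : ∃ S : Set (Euc d) → Set (Euc d),
    (∀ T ∈ M.elements,
      (∃ p : Fin (d + 1) → Euc d, AffineIndependent ℝ p ∧ S T = convexHull ℝ (Set.range p)) ∧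
      T ⊆ S T ∧ size (S T) ≤ c.gamma * size T ∧
      ∃ z : Euc d, Metric.closedBall z (c.tau * size (S T)) ⊆ S T) ∧
    ∀ T ∈ M.elements,
      (M.elements.filter (fun T' => T' ≠ T ∧ (S T ∩ S T').Nonempty)).card ≤ c.overlap

/-! ### Polynomial spaces and weak finite element functions -/

/-- `f` is a polynomial of degree at most `r` in `d` variables. -/
def IsPoly {d : ℕ} (r : ℕ) (f : Euc d → ℝ) : Prop :=
  ∃ p : MvPolynomial (Fin d) ℝ, p.totalDegree ≤ r ∧ ∀ x : Euc d, f x = MvPolynomial.eval (fun i => x i) p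

/-- `f ∈ [P_r]^d`. -/
def IsPolyVec {d : ℕ} (r : ℕ) (f : Euc d → Euc d) : Prop :=
  ∀ i, IsPoly r (fun x => f x i)

/-- `φ ∈ [P_r]^{d × d}`. -/
def IsPolyMat {d : ℕ} (r : ℕ) (φ : Euc d → Matrix (Fin d) (Fin d) ℝ) : Prop :=
  ∀ i j, IsPoly r (fun x => φ x i j)

/-- `f` is a rigid motion `x ↦ a + η x` with `η` skew-symmetric. -/
def IsRigidMotion {d : ℕ} (f : Euc d → Euc d) : Prop :=
  ∃ (a : Euc d) (η : Matrix (Fin d) (Fin d) ℝ), ηᵀ = -η ∧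
    ∀ x : Euc d, f x = a + Matrix.toEuclideanLin η x

/-- The restriction of `f` to the side `e` belongs to `V_r(e) = [P_r(e)]^d + P_RM(e)`. -/
def InSideSpace {d : ℕ} (r : ℕ) (e : Set (Euc d)) (f : Euc d → Euc d) : Prop :=
  ∃ p q : Euc d → Euc d, IsPolyVec r p ∧ IsRigidMotion q ∧ ∀ x ∈ e, f x = p x + q x

/-- A weak function `v = {v₀, v_b}` on a mesh: `v.inn T` is `v₀` on the element `T` and `v.bdy e` is
`v_b` on the side `e`; as it does not depend on the element, `v_b` is single-valued. -/
structure WeakFun (d : ℕ) where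
  inn : Set (Euc d) → Euc d → Euc d
  bdy : Set (Euc d) → Euc d → Euc d

/-- The space `V_h`. A polynomial on `T` is identified with the polynomial on `ℝ^d` that it
determines; only the values of `v.bdy e` on `e` matter. -/
def InV {d : ℕ} (k : ℕ) (M : Mesh d) (v : WeakFun d) : Prop :=
  (∀ T ∈ M.elements, IsPolyVec k (v.inn T)) ∧ ∀ e ∈ M.sides, InSideSpace (k - 1) e (v.bdy e)

/-- The space `V_h^0` of functions in `V_h` with `v_b = 0` on `∂Ω`. -/
def InV0 {d : ℕ} (k : ℕ) (Ω : Set (Euc d)) (M : Mesh d) (v : WeakFun d) : Prop :=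
  InV k M v ∧ ∀ e ∈ M.sides, e ⊆ frontier Ω → ∀ x ∈ e, v.bdy e x = 0

/-! ### Differential operators and projections -/

/-- The partial derivative `∂_i f`. -/
def pd {d : ℕ} (i : Fin d) (f : Euc d → ℝ) (x : Euc d) : ℝ :=
  fderiv ℝ f x (EuclideanSpace.single i 1)

/-- The row-wise divergence of a matrix-valued function. -/
def divMat {d : ℕ} (φ : Euc d → Matrix (Fin d) (Fin d) ℝ) (x : Euc d) : Euc d :=
  WithLp.toLp 2 (fun i => ∑ j, pd j (fun y => φ y i j) x)

/-- The strain tensor `ε(u) = (∇u + ∇uᵀ) / 2`. -/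
def strain {d : ℕ} (u : Euc d → Euc d) (x : Euc d) : Matrix (Fin d) (Fin d) ℝ :=
  Matrix.of (fun i j => (pd j (fun y => u y i) x + pd i (fun y => u y j) x) / 2)

/-- The Frobenius inner product of matrices. -/
def frob {d : ℕ} (A B : Matrix (Fin d) (Fin d) ℝ) : ℝ := ∑ i, ∑ j, A i j * B i j

/-- The `L²(T)` inner product of matrix-valued functions. -/
def ipElem {d : ℕ} (T : Set (Euc d)) (A B : Euc d → Matrix (Fin d) (Fin d) ℝ) : ℝ :=
  ∫ x in T, frob (A x) (B x)

/-- The `L²(e)` inner product of vector-valued functions on a side `e`. -/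
def ipSide {d : ℕ} (e : Set (Euc d)) (f g : Euc d → Euc d) : ℝ :=
  ∫ x in e, inner ℝ (f x) (g x) ∂(surf d)

/-- `G` is the discrete weak gradient of `v` on `T`: the polynomial in `[P_r(T)]^{d × d}` with
`(G, φ)_T = -(v₀, ∇·φ)_T + ⟨v_b, φ n⟩_{∂T}` for all `φ ∈ [P_r(T)]^{d × d}`. -/
def IsWeakGrad {d : ℕ} (r : ℕ) (M : Mesh d) (T : Set (Euc d)) (v : WeakFun d)
    (G : Euc d → Matrix (Fin d) (Fin d) ℝ) : Prop :=
  IsPolyMat r G ∧ ∀ φ : Euc d → Matrix (Fin d) (Fin d) ℝ, IsPolyMat r φ →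
    ipElem T G φ = -(∫ x in T, inner ℝ (v.inn T x) (divMat φ x)) +
      ∑ e ∈ M.sidesOf T,
        ipSide e (v.bdy e) (fun x => Matrix.toEuclideanLin (φ x) (outwardNormal T e))

/-- The discrete weak gradient `∇_{w,r,T} v`. -/
def weakGrad {d : ℕ} (r : ℕ) (M : Mesh d) (v : WeakFun d) (T : Set (Euc d)) :
    Euc d → Matrix (Fin d) (Fin d) ℝ :=
  Classical.epsilon (IsWeakGrad r M T v)

/-- The discrete weak strain tensor `ε_w(v) = (∇_w v + (∇_w v)ᵀ) / 2` on `T`. -/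
def weakStrain {d : ℕ} (r : ℕ) (M : Mesh d) (v : WeakFun d) (T : Set (Euc d)) (x : Euc d) :
    Matrix (Fin d) (Fin d) ℝ :=
  (1 / 2 : ℝ) • (weakGrad r M v T x + (weakGrad r M v T x)ᵀ)

/-- `w` is the `L²(e)` projection of `f` onto `V_r(e)`. -/
def IsSideProj {d : ℕ} (r : ℕ) (e : Set (Euc d)) (f w : Euc d → Euc d) : Prop :=
  InSideSpace r e w ∧ ∀ z : Euc d → Euc d, InSideSpace r e z → ipSide e (fun x => f x - w x) z = 0

/-- The `L²` projection `Q_b f` of `f` onto `V_r(e)`. -/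
def sideProj {d : ℕ} (r : ℕ) (e : Set (Euc d)) (f : Euc d → Euc d) : Euc d → Euc d :=
  Classical.epsilon (IsSideProj r e f)

/-! ### The bilinear form and the norm -/

/-- The jump `Q_b v₀ - v_b` on the side `e` of `T`. -/
def jump {d : ℕ} (k : ℕ) (v : WeakFun d) (T e : Set (Euc d)) (x : Euc d) : Euc d :=
  sideProj (k - 1) e (v.inn T) x - v.bdy e x

/-- The stabilizer `s(w, v) = ∑_T h_T⁻¹ ⟨Q_b w₀ - w_b, Q_b v₀ - v_b⟩_{∂T}`. -/
def stab {d : ℕ} (k : ℕ) (M : Mesh d) (w v : WeakFun d) : ℝ :=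
  ∑ T ∈ M.elements, (size T)⁻¹ * ∑ e ∈ M.sidesOf T, ipSide e (jump k w T e) (jump k v T e)

/-- `a(w, v) = 2 ∑_T (μ ε_w(w), ε_w(v))_T + s(w, v)`. -/
def bilinA {d : ℕ} (k : ℕ) (μ : ℝ) (M : Mesh d) (w v : WeakFun d) : ℝ :=
  2 * ∑ T ∈ M.elements,
      ipElem T (fun x => μ • weakStrain (k - 1) M w T x) (weakStrain (k - 1) M v T) +
    stab k M w v

/-- The (semi-)norm
`|||v||| = (∑_T (‖ε(v₀)‖_T² + h_T⁻¹ ‖Q_b v₀ - v_b‖_{∂T}²))^{1/2}`. -/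
def tripleNorm {d : ℕ} (k : ℕ) (M : Mesh d) (v : WeakFun d) : ℝ :=
  Real.sqrt (∑ T ∈ M.elements, (ipElem T (strain (v.inn T)) (strain (v.inn T)) +
    (size T)⁻¹ * ∑ e ∈ M.sidesOf T, ipSide e (jump k v T e) (jump k v T e)))

end WG

end

noncomputable section

namespace WG

/-! ### Integration in coordinates adapted to a hyperplane -/

/-! The argument is local to one element `T`: the weak strain and the classical strain differ by at
most the jumps. Put `φ = ε_w(v) - ε(v₀)`, a symmetric matrix field of degree at most `k - 1`.
Integration by parts in the definition of the weak gradient gives `(∇_w v, φ)_T = (∇v₀, φ)_T - ⟨v₀ -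
v_b, φ n⟩_{∂T}`. On a flat side `n` is constant, so `φ n` belongs to `V_{k-1}(e)` and `v₀` may be
replaced by `Q_b v₀`. Since `φ` is symmetric this says `‖φ‖_T² = -⟨Q_b v₀ - v_b, φ n⟩_{∂T}`. Young's
inequality and the trace inequality `‖φ n‖_e² ≤ C h_T⁻¹ ‖φ‖_T²` absorb `φ` on the left and leave
`‖φ‖_T² ≤ K h_T⁻¹ ‖Q_b v₀ - v_b‖_{∂T}²` (`FlatSided.strain_sub_le`). Both bounds then follow from
`‖A‖² ≤ 2‖B‖² + 2‖A - B‖²` and summation over the elements.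

Two analytic facts carry this. The divergence theorem on a polytope (`FlatSided.integral_fderiv`) is
proved for one direction `v` at a time: up to a null set, the indicator of `T` is the sum over its
sides of `sign(n_e · v)` times the indicator of the shadow that the side casts in direction `-v`,
and over one shadow the derivative along `v` integrates to a surface integral over the side. The
trace inequality (`exists_trace_inequality`) comes from the pyramids: on each segment from the apex
to the base a polynomial restricts to one variable, where its endpoint value is bounded by a
weighted `L²` norm, and integrating over the base recovers an integral over the pyramid.

The weak gradient and `Q_b` are defined by choice, so their existence must be shown;
`exists_representer` gives both. -/

lemma finrank_orthogonal_unit {d : ℕ} {n : Euc d} (hn : ‖n‖ = 1) :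
    Module.finrank ℝ (ℝ ∙ n)ᗮ = d - 1 := by
  have h := (ℝ ∙ n).finrank_add_finrank_orthogonal
  rw [finrank_span_singleton (by rintro rfl; simp at hn), finrank_euclideanSpace_fin] at h
  omega

lemma isometry_hyperplane {d : ℕ} (p n : Euc d) :
    Isometry (fun z : (ℝ ∙ n)ᗮ => p + (z : Euc d)) :=
  (IsometryEquiv.addLeft p).isometry.comp isometry_subtype_coe

lemma measurableEmbedding_hyperplane {d : ℕ} (p n : Euc d) :
    MeasurableEmbedding (fun z : (ℝ ∙ n)ᗮ => p + (z : Euc d)) :=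
  (isometry_hyperplane p n).isClosedEmbedding.measurableEmbedding

lemma range_hyperplane {d : ℕ} (p n : Euc d) :
    Set.range (fun z : (ℝ ∙ n)ᗮ => p + (z : Euc d)) = {x | inner ℝ n (x - p) = 0} := by
  ext x
  simp only [Set.mem_range, Set.mem_ofPred_eq]
  constructor
  · rintro ⟨z, rfl⟩
    simpa using Submodule.mem_orthogonal_singleton_iff_inner_right.1 z.2
  · intro hx
    exact ⟨⟨x - p, Submodule.mem_orthogonal_singleton_iff_inner_right.2 hx⟩, by simp⟩

/-- The normalized Hausdorff measure is carried along by isometries and equals the volume on an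
inner product space of dimension `d - 1`. This turns surface integrals into Lebesgue integrals over
`nᗮ`. -/
lemma map_volume_hyperplane {d : ℕ} (p : Euc d) {n : Euc d} (hn : ‖n‖ = 1) :
    Measure.map (fun z : (ℝ ∙ n)ᗮ => p + (z : Euc d)) volume =
      (surf d).restrict {x | inner ℝ n (x - p) = 0} := by
  rw [← range_hyperplane, ← (isometry_hyperplane p n).map_euclideanHausdorffMeasure,
    ← InnerProductSpace.euclideanHausdorffMeasure_eq_volume, finrank_orthogonal_unit hn]

lemma surf_restrict_eq {d : ℕ} {p n : Euc d} (hn : ‖n‖ = 1) {e : Set (Euc d)}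
    (he : e ⊆ {x | inner ℝ n (x - p) = 0}) (hm : MeasurableSet e) :
    (surf d).restrict e =
      (Measure.map (fun z : (ℝ ∙ n)ᗮ => p + (z : Euc d)) volume).restrict e := by
  rw [map_volume_hyperplane p hn, Measure.restrict_restrict hm, Set.inter_eq_left.2 he]

lemma setIntegral_surf {d : ℕ} {p n : Euc d} (hn : ‖n‖ = 1) {e : Set (Euc d)}
    (he : e ⊆ {x | inner ℝ n (x - p) = 0}) (hm : MeasurableSet e) (F : Euc d → ℝ) :
    ∫ x in e, F x ∂(surf d) =
      ∫ z in (fun z : (ℝ ∙ n)ᗮ => p + (z : Euc d)) ⁻¹' e, F (p + z) := by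
  rw [surf_restrict_eq hn he hm, (measurableEmbedding_hyperplane p n).setIntegral_map]

lemma setLIntegral_surf {d : ℕ} {p n : Euc d} (hn : ‖n‖ = 1) {e : Set (Euc d)}
    (he : e ⊆ {x | inner ℝ n (x - p) = 0}) (hm : MeasurableSet e) (F : Euc d → ENNReal) :
    ∫⁻ x in e, F x ∂(surf d) =
      ∫⁻ z in (fun z : (ℝ ∙ n)ᗮ => p + (z : Euc d)) ⁻¹' e, F (p + z) := by
  rw [surf_restrict_eq hn he hm, (measurableEmbedding_hyperplane p n).restrict_map,
    (measurableEmbedding_hyperplane p n).lintegral_map]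

lemma isCompact_preimage_hyperplane {d : ℕ} (p n : Euc d) {e : Set (Euc d)} (he : IsCompact e) :
    IsCompact ((fun z : (ℝ ∙ n)ᗮ => p + (z : Euc d)) ⁻¹' e) :=
  (isometry_hyperplane p n).isClosedEmbedding.isCompact_preimage he

lemma surf_lt_top {d : ℕ} {p n : Euc d} (hn : ‖n‖ = 1) {e : Set (Euc d)}
    (he : e ⊆ {x | inner ℝ n (x - p) = 0}) (hc : IsCompact e) : surf d e < ⊤ := by
  have h := setLIntegral_surf hn he hc.measurableSet (fun _ => 1)
  simp only [lintegral_one, Measure.restrict_apply MeasurableSet.univ, Set.univ_inter] at h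
  rw [h]
  exact (isCompact_preimage_hyperplane p n hc).measure_lt_top

/-- Orthogonal coordinates: height along the unit normal `n`, and position in the hyperplane. -/
lemma measurePreserving_normal {d : ℕ} (p : Euc d) {n : Euc d} (hn : ‖n‖ = 1) :
    MeasurePreserving (fun q : ℝ × (ℝ ∙ n)ᗮ => p + (q.2 : Euc d) + q.1 • n) volume volume := by
  have h1 := (ℝ ∙ n).measurePreserving_measurableEquivProd p
  rw [InnerProductSpace.euclideanHausdorffMeasure_eq_volume] at h1
  have h2 := (LinearIsometryEquiv.toSpanUnitSingleton (𝕜 := ℝ) n hn).measurePreserving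
  have h3 := h1.symm.comp (h2.prod (MeasurePreserving.id (volume : Measure (ℝ ∙ n)ᗮ)))
  convert! h3 using 1
  ext1 q
  simp [Submodule.measurableEquivProd_symm_apply]
  abel

/-- Oblique coordinates: position in the hyperplane, and a multiple of the direction `v`. -/
lemma map_oblique {d : ℕ} (p : Euc d) {n v : Euc d} (hn : ‖n‖ = 1) (hv : inner ℝ n v ≠ 0) :
    Measure.map (fun q : ℝ × (ℝ ∙ n)ᗮ => p + (q.2 : Euc d) + q.1 • v) volume =
      ENNReal.ofReal |inner ℝ n v|⁻¹ • (volume : Measure (Euc d)) := by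
  -- Write `v = c n + w` with `w` tangential. The oblique chart is a shear by `w`, which preserves
  -- volume, then a scaling of the height by `c`, which gives the factor `|c|⁻¹`, then the
  -- orthogonal chart.
  set c : ℝ := inner ℝ n v with hc
  have hw : v - c • n ∈ (ℝ ∙ n)ᗮ := by
    rw [Submodule.mem_orthogonal_singleton_iff_inner_right, inner_sub_right, inner_smul_right,
      real_inner_self_eq_norm_sq, hn]
    simp [hc]
  set w : (ℝ ∙ n)ᗮ := ⟨v - c • n, hw⟩
  have hshear : MeasurePreserving (fun q : ℝ × (ℝ ∙ n)ᗮ => (q.1, q.2 + q.1 • w)) volume volume := by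
    refine (MeasurePreserving.id (volume : Measure ℝ)).skew_product
      (g := fun s z => z + s • w) (by fun_prop) ?_
    exact Filter.Eventually.of_forall fun s => (measurePreserving_add_right volume (s • w)).map_eq
  have hscale : Measure.map (fun q : ℝ × (ℝ ∙ n)ᗮ => (c * q.1, q.2)) volume =
      ENNReal.ofReal |c⁻¹| • (volume : Measure (ℝ × (ℝ ∙ n)ᗮ)) := by
    have h := Measure.map_prod_map (volume : Measure ℝ) (volume : Measure (ℝ ∙ n)ᗮ)
      (f := fun s => c * s) (g := id) (by fun_prop) measurable_id
    rw [Real.map_volume_mul_left hv, Measure.map_id, Measure.prod_smul_left] at h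
    exact h.symm
  have hcomp : (fun q : ℝ × (ℝ ∙ n)ᗮ => p + (q.2 : Euc d) + q.1 • v) =
      (fun q : ℝ × (ℝ ∙ n)ᗮ => p + (q.2 : Euc d) + q.1 • n) ∘
        (fun q : ℝ × (ℝ ∙ n)ᗮ => (c * q.1, q.2)) ∘
          (fun q : ℝ × (ℝ ∙ n)ᗮ => (q.1, q.2 + q.1 • w)) := by
    ext1 q
    simp only [Function.comp, w, Submodule.coe_add, Submodule.coe_smul, smul_sub, smul_smul,
      mul_comm c]
    abel
  rw [hcomp, ← Measure.map_map (by fun_prop) (by fun_prop),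
    ← Measure.map_map (by fun_prop) (by fun_prop), hshear.map_eq, hscale, Measure.map_smul,
    (measurePreserving_normal p hn).map_eq, abs_inv]

/-- The shadow of a flat set `e` in the direction `-v`. -/
def shadow {d : ℕ} (v : Euc d) (e : Set (Euc d)) : Set (Euc d) := {x | ∃ t : ℝ, 0 < t ∧ x + t • v ∈ e}

lemma injective_oblique {d : ℕ} (p : Euc d) {n v : Euc d} (hv : inner ℝ n v ≠ 0) :
    Function.Injective (fun q : ℝ × (ℝ ∙ n)ᗮ => p + (q.2 : Euc d) + q.1 • v) := by
  rintro ⟨s, z⟩ ⟨s', z'⟩ h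
  simp only at h
  have h1 := congrArg (fun x => inner ℝ n x) h
  simp only [inner_add_right, inner_smul_right,
    Submodule.mem_orthogonal_singleton_iff_inner_right.1 z.2,
    Submodule.mem_orthogonal_singleton_iff_inner_right.1 z'.2] at h1
  have h2 : s = s' := mul_right_cancel₀ hv (by linarith)
  subst h2
  simpa using h

/-- A line transversal to the hyperplane meets it only at oblique height zero, so in oblique
coordinates the shadow is a product, ready for Fubini. -/
lemma preimage_shadow {d : ℕ} {p n v : Euc d} (hv : inner ℝ n v ≠ 0) {e : Set (Euc d)}
    (he : e ⊆ {x | inner ℝ n (x - p) = 0}) :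
    (fun q : ℝ × (ℝ ∙ n)ᗮ => p + (q.2 : Euc d) + q.1 • v) ⁻¹' (shadow v e) =
      Set.Iio 0 ×ˢ ((fun z : (ℝ ∙ n)ᗮ => p + (z : Euc d)) ⁻¹' e) := by
  ext ⟨s, z⟩
  simp only [shadow, Set.mem_preimage, Set.mem_ofPred_eq, Set.mem_prod, Set.mem_Iio]
  have key : ∀ t : ℝ, p + (z : Euc d) + s • v + t • v = p + z + (s + t) • v := fun t => by
    rw [add_smul]; abel
  constructor
  · rintro ⟨t, ht, hx⟩
    have h0 := he hx
    rw [key] at h0 hx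
    simp only [Set.mem_ofPred_eq, inner_sub_right, inner_add_right, inner_smul_right,
      Submodule.mem_orthogonal_singleton_iff_inner_right.1 z.2] at h0
    have h1 : s + t = 0 := by
      have : (s + t) * inner ℝ n v = 0 := by linarith
      exact (mul_eq_zero.1 this).resolve_right hv
    rw [h1] at hx
    exact ⟨by linarith, by simpa using hx⟩
  · rintro ⟨hs, hx⟩
    exact ⟨-s, by linarith, by simpa using hx⟩

lemma measurableEmbedding_oblique {d : ℕ} (p : Euc d) {n v : Euc d} (hv : inner ℝ n v ≠ 0) :
    MeasurableEmbedding (fun q : ℝ × (ℝ ∙ n)ᗮ => p + (q.2 : Euc d) + q.1 • v) :=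
  Continuous.measurableEmbedding (by fun_prop) (injective_oblique p hv)

lemma hyperplane_ne_top {d : ℕ} (p : Euc d) {n : Euc d} (hn : ‖n‖ = 1) :
    AffineSubspace.mk' p (ℝ ∙ n)ᗮ ≠ ⊤ := by
  intro h
  have h1 : p + n ∈ AffineSubspace.mk' p (ℝ ∙ n)ᗮ := by rw [h]; trivial
  rw [AffineSubspace.mem_mk', vsub_eq_sub, add_sub_cancel_left,
    Submodule.mem_orthogonal_singleton_iff_inner_right, real_inner_self_eq_norm_sq, hn] at h1
  norm_num at h1

lemma volume_hyperplane {d : ℕ} (p : Euc d) {n : Euc d} (hn : ‖n‖ = 1) :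
    volume {x : Euc d | inner ℝ n (x - p) = 0} = 0 := by
  have h := Measure.addHaar_affineSubspace (volume : Measure (Euc d)) _ (hyperplane_ne_top p hn)
  convert! h using 2
  ext x
  simp [AffineSubspace.mem_mk', Submodule.mem_orthogonal_singleton_iff_inner_right]

lemma measurableSet_shadow {d : ℕ} {p n v : Euc d} (hv : inner ℝ n v ≠ 0)
    {e : Set (Euc d)} (he : e ⊆ {x | inner ℝ n (x - p) = 0}) (hm : MeasurableSet e) :
    MeasurableSet (shadow v e) := by
  have h1 : shadow v e = (fun q : ℝ × (ℝ ∙ n)ᗮ => p + (q.2 : Euc d) + q.1 • v) ''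
      (Set.Iio 0 ×ˢ ((fun z : (ℝ ∙ n)ᗮ => p + (z : Euc d)) ⁻¹' e)) := by
    rw [← preimage_shadow hv he, Set.image_preimage_eq_iff.2]
    rintro x ⟨t, -, hx⟩
    have h2 : x + t • v ∈ Set.range (fun z : (ℝ ∙ n)ᗮ => p + (z : Euc d)) := by
      rw [range_hyperplane]; exact he hx
    obtain ⟨z, hz⟩ := h2
    refine ⟨(-t, z), ?_⟩
    simp only at hz ⊢
    rw [hz]
    simp
  rw [h1, (measurableEmbedding_oblique p hv).measurableSet_image]
  exact measurableSet_Iio.prod ((measurableEmbedding_hyperplane p n).measurable hm)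

/-- The integral of a directional derivative over the shadow of a flat set. -/
lemma setIntegral_shadow {d : ℕ} {p n v : Euc d} (hn : ‖n‖ = 1) (hv : inner ℝ n v ≠ 0)
    {e : Set (Euc d)} (he : e ⊆ {x | inner ℝ n (x - p) = 0}) (hm : MeasurableSet e)
    {f : Euc d → ℝ} (hf : ContDiff ℝ 1 f) (hf' : HasCompactSupport f) :
    ∫ x in shadow v e, fderiv ℝ f x v = |inner ℝ n v| * ∫ x in e, f x ∂(surf d) := by
  set c : ℝ := inner ℝ n v with hc
  have hgc : Continuous fun x => fderiv ℝ f x v :=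
    (hf.continuous_fderiv one_ne_zero).clm_apply continuous_const
  have hgs : HasCompactSupport fun x => fderiv ℝ f x v := by
    refine hf'.fderiv (𝕜 := ℝ) |>.comp_left (g := fun L : Euc d →L[ℝ] ℝ => L v) rfl
  have hgi : Integrable (fun x => fderiv ℝ f x v) volume := hgc.integrable_of_hasCompactSupport hgs
  have hmap := map_oblique p hn hv
  have hemb := measurableEmbedding_oblique p hv
  have h1 : ∫ x in shadow v e, fderiv ℝ f x v ∂(ENNReal.ofReal |c|⁻¹ • (volume : Measure (Euc d))) =
      |c|⁻¹ * ∫ x in shadow v e, fderiv ℝ f x v := by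
    rw [Measure.restrict_smul, integral_smul_measure, ENNReal.toReal_ofReal (by positivity),
      smul_eq_mul]
  have hint : Integrable ((fun x => fderiv ℝ f x v) ∘
      (fun q : ℝ × (ℝ ∙ n)ᗮ => p + (q.2 : Euc d) + q.1 • v)) volume := by
    rw [← hemb.integrable_map_iff, hmap]
    exact hgi.smul_measure ENNReal.ofReal_ne_top
  rw [← hmap, hemb.setIntegral_map, preimage_shadow hv he] at h1
  -- The fundamental theorem of calculus on the half line ending at `y`; compact support removes the
  -- contribution from `-∞`.
  have hline : ∀ y : Euc d, ∫ s in Set.Iio (0 : ℝ), fderiv ℝ f (y + s • v) v = f y := fun y => by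
    have hdl : ∀ s : ℝ, HasDerivAt (fun s : ℝ => y + s • v) v s := fun s => by
      simpa using ((hasDerivAt_id s).smul_const v).const_add y
    have hd : ∀ s : ℝ, deriv (fun s : ℝ => f (y + s • v)) s = fderiv ℝ f (y + s • v) v := fun s =>
      ((hf.differentiable one_ne_zero (y + s • v)).hasFDerivAt.comp_hasDerivAt s (hdl s)).deriv
    have hv0 : v ≠ 0 := by
      rintro rfl
      simp [hc] at hv
    have hcl : Topology.IsClosedEmbedding (fun s : ℝ => y + s • v) :=
      (Homeomorph.addLeft y).isClosedEmbedding.comp (isClosedEmbedding_smul_left hv0)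
    have h := HasCompactSupport.integral_Iic_deriv_eq (f := fun s : ℝ => f (y + s • v))
      (hf.comp (by fun_prop)) (hf'.comp_isClosedEmbedding hcl) 0
    simp only [hd, zero_smul, add_zero] at h
    rw [← integral_Iic_eq_integral_Iio, h]
  have h2 : ∫ q in Set.Iio (0 : ℝ) ×ˢ ((fun z : (ℝ ∙ n)ᗮ => p + (z : Euc d)) ⁻¹' e),
      fderiv ℝ f (p + (q.2 : Euc d) + q.1 • v) v =
      ∫ z in (fun z : (ℝ ∙ n)ᗮ => p + (z : Euc d)) ⁻¹' e, f (p + z) := by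
    have hi := hint.integrableOn
      (s := Set.Iio (0 : ℝ) ×ˢ ((fun z : (ℝ ∙ n)ᗮ => p + (z : Euc d)) ⁻¹' e))
    rw [IntegrableOn, Measure.volume_eq_prod, ← Measure.prod_restrict] at hi
    rw [Measure.volume_eq_prod, ← Measure.prod_restrict]
    refine (integral_prod_symm _ hi).trans ?_
    exact integral_congr_ae (Filter.Eventually.of_forall fun z => hline (p + z))
  rw [h2] at h1
  rw [setIntegral_surf hn he hm, h1, ← mul_assoc, mul_inv_cancel₀ (abs_ne_zero.2 hv), one_mul]

/-- Serves both substitutions in a cone: the height variable is scaled by `H`, and the slice at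
relative height `t` by `t`, which gives the Jacobian `t ^ (d - 1)`. -/
lemma lintegral_eq_smul_dilate {V : Type*} [NormedAddCommGroup V] [NormedSpace ℝ V]
    [FiniteDimensional ℝ V] [MeasurableSpace V] [BorelSpace V] (ν : Measure V) [ν.IsAddHaarMeasure]
    {r : ℝ} (hr : 0 < r) (g : V → ENNReal) (hg : Measurable g) :
    ∫⁻ z, g z ∂ν = ENNReal.ofReal (r ^ Module.finrank ℝ V) * ∫⁻ z, g (r • z) ∂ν := by
  have h := Measure.map_addHaar_smul ν hr.ne'
  have h2 : ∫⁻ z, g (r • z) ∂ν = ∫⁻ z, g z ∂(Measure.map (fun z => r • z) ν) :=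
    (lintegral_map hg (by fun_prop)).symm
  have hp : 0 < r ^ Module.finrank ℝ V := by positivity
  rw [h2, h, lintegral_smul_measure, smul_eq_mul, ← mul_assoc, ← ENNReal.ofReal_mul hp.le,
    abs_of_pos (inv_pos.2 hp), mul_inv_cancel₀ hp.ne', ENNReal.ofReal_one, one_mul]

/-- Integration over a pyramid with apex `A`, base `e` and height `H` that is contained in `T`. -/
lemma lintegral_cone_le {d : ℕ} {A n : Euc d} (hn : ‖n‖ = 1) {H : ℝ} (hH : 0 < H)
    {e T : Set (Euc d)} (he : ∀ x ∈ e, inner ℝ n (x - A) = H) (hm : MeasurableSet e)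
    (hT : MeasurableSet T) (hcone : ∀ y ∈ e, ∀ t ∈ Set.Ioo (0 : ℝ) 1, A + t • (y - A) ∈ T)
    {F : Euc d → ENNReal} (hF : Measurable F) :
    ENNReal.ofReal H * ∫⁻ y in e, (∫⁻ t in Set.Ioo (0 : ℝ) 1,
      ENNReal.ofReal (t ^ (d - 1)) * F (A + t • (y - A))) ∂(surf d) ≤ ∫⁻ x in T, F x := by
  have he' : e ⊆ {x | inner ℝ n (x - (A + H • n)) = 0} := fun x hx => by
    have h := he x hx
    simp only [Set.mem_ofPred_eq]
    rw [← sub_sub, inner_sub_right, h, inner_smul_right, real_inner_self_eq_norm_sq, hn]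
    ring
  set e' := (fun z : (ℝ ∙ n)ᗮ => A + H • n + (z : Euc d)) ⁻¹' e with he'_def
  have hGm : Measurable (T.indicator F) := hF.indicator hT
  have hfin := finrank_orthogonal_unit hn
  -- Heights are measured from the apex in units of `H`, so the base sits at `t = 1`. Only an
  -- inequality survives later, when `t` is restricted to `(0, 1)` and the slice to the `t`-dilate
  -- of the base.
  have h1 : ∫⁻ x in T, F x =
      ENNReal.ofReal H * ∫⁻ t : ℝ, ∫⁻ z : (ℝ ∙ n)ᗮ, T.indicator F (A + z + (H * t) • n) := by
    rw [← lintegral_indicator hT,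
      ← (measurePreserving_normal A hn).lintegral_comp hGm, Measure.volume_eq_prod,
      lintegral_prod _ (by fun_prop)]
    have := lintegral_eq_smul_dilate (volume : Measure ℝ) hH
      (fun s => ∫⁻ z : (ℝ ∙ n)ᗮ, T.indicator F (A + z + s • n))
      (Measurable.lintegral_prod_right' (f := fun q : ℝ × (ℝ ∙ n)ᗮ =>
        T.indicator F (A + q.2 + q.1 • n)) (by fun_prop))
    simpa using this
  rw [h1, setLIntegral_surf hn he' hm]
  gcongr ENNReal.ofReal H * ?_
  rw [lintegral_lintegral_swap (by fun_prop)]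
  refine le_trans ?_ (setLIntegral_le_lintegral (Set.Ioo (0 : ℝ) 1) _)
  refine setLIntegral_mono' measurableSet_Ioo fun t ht => ?_
  rw [lintegral_eq_smul_dilate volume ht.1 _ (by fun_prop), hfin,
    lintegral_const_mul _ (by fun_prop)]
  refine mul_le_mul_right ?_ _
  refine le_trans ?_ (setLIntegral_le_lintegral e' _)
  refine setLIntegral_mono' ((measurableEmbedding_hyperplane _ n).measurable hm) fun z hz => ?_
  have hpt : A + ((t • z : (ℝ ∙ n)ᗮ) : Euc d) + (H * t) • n =
      A + t • (A + H • n + (z : Euc d) - A) := by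
    rw [Submodule.coe_smul, add_assoc A (H • n), add_sub_cancel_left, smul_add, smul_smul,
      mul_comm H t]
    abel
  rw [hpt, Set.indicator_of_mem (hcone _ hz t ht)]

end WG

namespace WG

open Filter Topology

/-! ### The divergence theorem on a polytope -/

/-- The points whose line in direction `v` meets `Q` lie in the affine subspace that `Q` sweeps out
along `v`; its dimension is at most `d - 1`, so it is a null set. -/
lemma ae_line_notMem_affineSubspace {d : ℕ} (v : Euc d) (Q : AffineSubspace ℝ (Euc d))
    (hQ : Module.finrank ℝ Q.direction + 2 ≤ d) : ∀ᵐ x : Euc d, ∀ t : ℝ, x + t • v ∉ Q := by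
  rcases (Q : Set (Euc d)).eq_empty_or_nonempty with h | ⟨q, hq⟩
  · refine Eventually.of_forall fun x t hx => ?_
    have : x + t • v ∈ (Q : Set (Euc d)) := hx
    simp [h] at this
  set Q' : AffineSubspace ℝ (Euc d) := AffineSubspace.mk' q (Q.direction ⊔ ℝ ∙ v)
  have hQ' : Q' ≠ ⊤ := fun h => by
    have h1 : Q.direction ⊔ ℝ ∙ v = ⊤ := by
      rw [← AffineSubspace.direction_mk' q (Q.direction ⊔ ℝ ∙ v)]
      change Q'.direction = ⊤
      rw [h, AffineSubspace.direction_top]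
    have h2 := Submodule.finrank_add_le_finrank_add_finrank Q.direction (ℝ ∙ v)
    have h3 := finrank_span_le_card (R := ℝ) ({v} : Set (Euc d))
    rw [h1, finrank_top, finrank_euclideanSpace_fin] at h2
    simp only [Set.toFinset_singleton, Finset.card_singleton] at h3
    omega
  refine measure_mono_null ?_ (Measure.addHaar_affineSubspace volume Q' hQ')
  intro x hx
  simp only [Set.mem_compl_iff, Set.mem_ofPred_eq, not_forall, not_not] at hx
  obtain ⟨t, ht⟩ := hx
  change x ∈ AffineSubspace.mk' q (Q.direction ⊔ ℝ ∙ v)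
  rw [AffineSubspace.mem_mk', vsub_eq_sub]
  have h1 : x - q = (x + t • v - q) + (-t) • v := by rw [neg_smul]; abel
  rw [h1]
  exact Submodule.add_mem_sup (AffineSubspace.vsub_mem_direction ht hq)
    (Submodule.smul_mem _ _ (Submodule.mem_span_singleton_self v))

lemma IsPolytope.nonempty {d m : ℕ} {s : Set (Euc d)} (hs : IsPolytope m s) : s.Nonempty :=
  hs.connected.nonempty.mono intrinsicInterior_subset

/-- The relative boundary of a side is covered by finitely many proper subspaces of its affine span,
each empty or of dimension at most `d - 2`. -/
lemma IsPolytope.ae_line_notMem_intrinsicFrontier {d : ℕ} (hd : 1 ≤ d) {e : Set (Euc d)}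
    (he : IsPolytope (d - 1) e) (v : Euc d) :
    ∀ᵐ x : Euc d, ∀ t : ℝ, x + t • v ∉ intrinsicFrontier ℝ e := by
  obtain ⟨F, hF, hsub⟩ := he.flat
  have h : ∀ᵐ x : Euc d, ∀ Q ∈ F, ∀ t : ℝ, x + t • v ∉ Q := by
    rw [Finset.eventually_all]
    intro Q hQ
    rcases (Q : Set (Euc d)).eq_empty_or_nonempty with h | hne
    · refine Eventually.of_forall fun x t hx => ?_
      have : x + t • v ∈ (Q : Set (Euc d)) := hx
      simp [h] at this
    · refine ae_line_notMem_affineSubspace v Q ?_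
      have h1 := Submodule.finrank_lt_finrank_of_lt
        (AffineSubspace.direction_lt_of_nonempty (hF Q hQ) hne)
      rw [he.dim] at h1
      omega
  filter_upwards [h] with x hx t hxt
  obtain ⟨Q, hQ, hxQ⟩ := Set.mem_iUnion₂.1 (hsub hxt)
  exact hx Q hQ t hxQ

lemma IsOutwardNormal.subset_hyperplane {d : ℕ} {T e : Set (Euc d)} {n p : Euc d}
    (hn : IsOutwardNormal T e n) (hp : p ∈ e) : e ⊆ {x | inner ℝ n (x - p) = 0} :=
  fun x hx => hn.2.1 p hp x hx

lemma mem_intrinsicInterior_of_notMem_intrinsicFrontier {d : ℕ} {e : Set (Euc d)} {x : Euc d}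
    (hx : x ∈ e) (hx' : x ∉ intrinsicFrontier ℝ e) : x ∈ intrinsicInterior ℝ e := by
  have h : x ∈ intrinsicInterior ℝ e ∪ intrinsicFrontier ℝ e := by
    rw [intrinsicInterior_union_intrinsicFrontier]
    exact subset_intrinsicClosure hx
  exact h.resolve_right hx'

lemma subset_or_disjoint_of_disjoint_frontier {X : Type*} [TopologicalSpace X] {B T : Set X}
    (hB : IsPreconnected B) (h : Disjoint B (frontier T)) : B ⊆ T ∨ Disjoint B T := by
  have hsub : B ⊆ interior T ∪ (closure T)ᶜ := fun x hx => by
    by_contra hc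
    simp only [Set.mem_union, Set.mem_compl_iff, not_or, not_not] at hc
    exact Set.disjoint_left.1 h hx ⟨hc.2, hc.1⟩
  have hdis : Disjoint (interior T) (closure T)ᶜ :=
    (disjoint_compl_right (a := closure T)).mono_left (interior_subset.trans subset_closure)
  by_cases hne : (B ∩ interior T).Nonempty
  · exact .inl ((hB.subset_left_of_subset_union isOpen_interior isClosed_closure.isOpen_compl hdis
      hsub hne).trans interior_subset)
  · right
    rw [Set.disjoint_left]
    intro x hx hxT
    rcases hsub hx with h1 | h1
    · exact hne ⟨x, hx, h1⟩
    · exact h1 (subset_closure hxT)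

/-- Near a point `p` in the relative interior of a side, if the boundary of `T` is contained in the
hyperplane of this side, then `T` is the half space opposite to the outward normal. -/
lemma IsOutwardNormal.half_ball {d : ℕ} {T e : Set (Euc d)} {n p : Euc d}
    (hn : IsOutwardNormal T e n) (hp : p ∈ intrinsicInterior ℝ e) {U : Set (Euc d)} (hU : U ∈ 𝓝 p)
    (hfr : U ∩ frontier T ⊆ e) :
    ∀ᶠ y in 𝓝 p, (inner ℝ n (y - p) < 0 → y ∈ T) ∧ (0 < inner ℝ n (y - p) → y ∉ T) := by
  obtain ⟨r, hr, hrU⟩ := Metric.mem_nhds_iff.1 hU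
  obtain ⟨δ, hδ, hδT⟩ := hn.2.2 p hp
  have hpe : p ∈ e := intrinsicInterior_subset hp
  have hfr' : ∀ y ∈ Metric.ball p r, inner ℝ n (y - p) ≠ 0 → y ∉ frontier T := fun y hy h0 hyT =>
    h0 (hn.2.1 p hpe y (hfr ⟨hrU hy, hyT⟩))
  set s := min (δ / 2) (r / 2) with hs
  have hs0 : 0 < s := by positivity
  have hsδ : s < δ := (min_le_left _ _).trans_lt (by linarith)
  have hsr : s < r := (min_le_right _ _).trans_lt (by linarith)
  have hball : ∀ c : ℝ, |c| = s → p + c • n ∈ Metric.ball p r := fun c hc => by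
    simp [norm_smul, hn.1, hc, hsr]
  have hin : ∀ c : ℝ, inner ℝ n (p + c • n - p) = c := fun c => by
    rw [add_sub_cancel_left, inner_smul_right, real_inner_self_eq_norm_sq, hn.1]; ring
  have hcvx : ∀ c : ℝ, Convex ℝ (Metric.ball p r ∩ {y | 0 < inner ℝ (c • n) (y - p)}) := fun c => by
    refine (convex_ball p r).inter ?_
    have : {y | 0 < inner ℝ (c • n) (y - p)} = {y | inner ℝ (c • n) p < innerSL ℝ (c • n) y} := by
      ext y
      simp only [Set.mem_ofPred_eq, inner_sub_right, sub_pos, innerSL_apply_apply]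
    rw [this]
    exact convex_halfSpace_gt (innerSL ℝ (c • n)).isLinear _
  -- Each open half ball (`c = 1` and `c = -1`) is convex and misses the boundary of `T`, so it lies
  -- entirely inside or outside. The points `p ∓ s n` from the definition of the outward normal
  -- decide which.
  have hdich : ∀ c : ℝ, Metric.ball p r ∩ {y | 0 < inner ℝ (c • n) (y - p)} ⊆ T ∨
      Disjoint (Metric.ball p r ∩ {y | 0 < inner ℝ (c • n) (y - p)}) T := fun c => by
    refine subset_or_disjoint_of_disjoint_frontier (hcvx c).isPreconnected ?_
    refine Set.disjoint_left.2 fun y hy => hfr' y hy.1 fun h0 => ?_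
    have h1 : 0 < inner ℝ (c • n) (y - p) := hy.2
    rw [inner_smul_left, h0, mul_zero] at h1
    exact lt_irrefl _ h1
  obtain ⟨hminus, hplus⟩ := hδT s hs0 hsδ
  filter_upwards [Metric.ball_mem_nhds p hr] with y hy
  constructor
  · intro hlt
    rcases hdich (-1) with h | h
    · refine h ⟨hy, ?_⟩
      simp only [neg_smul, one_smul, Set.mem_ofPred_eq, inner_neg_left]
      linarith
    · refine absurd hminus (Set.disjoint_left.1 h ⟨?_, ?_⟩)
      · have := hball (-s) (by rw [abs_neg, abs_of_pos hs0])
        simpa [sub_eq_add_neg] using this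
      · have := hin (-s)
        simp only [neg_smul, one_smul, Set.mem_ofPred_eq, inner_neg_left]
        rw [sub_eq_add_neg p, ← neg_smul, this]
        linarith
  · intro hgt
    rcases hdich 1 with h | h
    · refine absurd (h ⟨hball s (abs_of_pos hs0), ?_⟩) hplus
      simp only [one_smul, Set.mem_ofPred_eq]
      rw [hin]
      exact hs0
    · exact Set.disjoint_left.1 h ⟨hy, by simpa using hgt⟩

/-- A function of a real variable that is constant in a punctured neighbourhood of each point and
vanishes near infinity also vanishes at each point near which it is constant. -/
lemma eq_zero_of_eventually_const {D : ℝ → ℝ} (h : ∀ t, ∃ c, ∀ᶠ s in 𝓝[≠] t, D s = c)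
    (h0 : ∀ᶠ s in atTop, D s = 0) {t₀ : ℝ} (ht : ∀ᶠ s in 𝓝 t₀, D s = D t₀) : D t₀ = 0 := by
  choose c hc using h
  have huniq : ∀ t a, (∀ᶠ s in 𝓝[≠] t, D s = a) → c t = a := fun t a ha => by
    obtain ⟨s, h1, h2⟩ := ((hc t).and ha).exists
    rw [← h1, h2]
  -- The punctured limit `c` is locally constant on the connected line, hence constant. `D` may
  -- differ from `c` at exceptional points, which is why `ht` is needed at `t₀`.
  have hloc : IsLocallyConstant c := by
    rw [IsLocallyConstant.iff_eventually_eq]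
    intro t
    obtain ⟨u, hu, hut, hsub⟩ : ∃ u, IsOpen u ∧ t ∈ u ∧ ∀ s ∈ u, s ≠ t → D s = c t := by
      have := eventually_nhdsWithin_iff.1 (hc t)
      obtain ⟨u, h1, h2, h3⟩ := eventually_nhds_iff.1 this
      exact ⟨u, h2, h3, fun s hs => h1 s hs⟩
    filter_upwards [hu.mem_nhds hut] with s hs
    by_cases hst : s = t
    · rw [hst]
    · refine huniq s _ (eventually_nhdsWithin_of_eventually_nhds ?_)
      filter_upwards [hu.mem_nhds hs, isOpen_ne.mem_nhds hst] with s' h1 h2 using hsub s' h1 h2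
  obtain ⟨R, hR⟩ := eventually_atTop.1 h0
  have h1 : c (R + 1) = 0 := huniq _ _ <| eventually_nhdsWithin_of_eventually_nhds <| by
    filter_upwards [lt_mem_nhds (show R < R + 1 by linarith)] with s hs using hR s hs.le
  rw [← huniq t₀ (D t₀) (eventually_nhdsWithin_of_eventually_nhds ht), ← h1]
  exact hloc.apply_eq_of_isPreconnected isPreconnected_univ (Set.mem_univ _) (Set.mem_univ _)

end WG

/-! ### Signed crossings of flat sides and the divergence theorem -/

namespace WG

open Filter Topology

/-- `T` is a compact set whose boundary is made of the flat sides `e ∈ S`, with the outward normals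
`N e`. -/
structure FlatSided {d : ℕ} (T : Set (Euc d)) (S : Finset (Set (Euc d)))
    (N : Set (Euc d) → Euc d) : Prop where
  compact : IsCompact T
  frontier_eq : frontier T = ⋃ e ∈ S, e
  polytope : ∀ e ∈ S, IsPolytope (d - 1) e
  disjoint : ∀ e ∈ S, ∀ e' ∈ S, e ≠ e' →
    Disjoint (intrinsicInterior ℝ e) (intrinsicInterior ℝ e')
  normal : ∀ e ∈ S, IsOutwardNormal T e (N e)

variable {d : ℕ} {T : Set (Euc d)} {S : Finset (Set (Euc d))} {N : Set (Euc d) → Euc d}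

lemma FlatSided.subset (h : FlatSided T S N) {e : Set (Euc d)} (he : e ∈ S) : e ⊆ T := by
  refine Set.Subset.trans ?_ h.compact.isClosed.frontier_subset
  rw [h.frontier_eq]
  exact Set.subset_biUnion_of_mem (u := fun e => e) he

lemma FlatSided.hyperplane (h : FlatSided T S N) {e : Set (Euc d)} (he : e ∈ S) :
    ∃ p ∈ e, e ⊆ {x | inner ℝ (N e) (x - p) = 0} := by
  obtain ⟨p, hp⟩ := (h.polytope e he).nonempty
  exact ⟨p, hp, (h.normal e he).subset_hyperplane hp⟩

/-- Genericity: almost every line in direction `v` crosses sides only transversally and in their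
relative interiors. If `v` is tangential to a side that the line meets, then `x` itself lies in the
hyperplane of that side, a null set. -/
lemma FlatSided.ae_good (h : FlatSided T S N) (hd : 1 ≤ d) (v : Euc d) :
    ∀ᵐ x : Euc d, x ∉ frontier T ∧ ∀ e ∈ S, ∀ t : ℝ, x + t • v ∈ e →
      inner ℝ (N e) v ≠ 0 ∧ x + t • v ∈ intrinsicInterior ℝ e := by
  have h1 : ∀ᵐ x : Euc d, ∀ e ∈ S, x ∉ e ∧ ∀ t : ℝ, x + t • v ∈ e →
      inner ℝ (N e) v ≠ 0 ∧ x + t • v ∈ intrinsicInterior ℝ e := by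
    rw [Finset.eventually_all]
    intro e he
    obtain ⟨p, hp, hsub⟩ := h.hyperplane he
    have h2 : ∀ᵐ x : Euc d, inner ℝ (N e) (x - p) ≠ 0 := by
      have := volume_hyperplane p (h.normal e he).1
      rw [ae_iff]
      simpa using this
    filter_upwards [h2, (h.polytope e he).ae_line_notMem_intrinsicFrontier hd v] with x hx hx'
    refine ⟨fun hxe => hx (hsub hxe), fun t ht => ⟨fun h0 => hx ?_,
      mem_intrinsicInterior_of_notMem_intrinsicFrontier ht (hx' t)⟩⟩
    have h3 : inner ℝ (N e) (x + t • v - p) = 0 := hsub ht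
    rw [add_sub_right_comm, inner_add_right, inner_smul_right, h0] at h3
    simpa using h3
  filter_upwards [h1] with x hx
  refine ⟨?_, fun e he => (hx e he).2⟩
  rw [h.frontier_eq]
  simp only [Set.mem_iUnion, not_exists]
  exact fun e he => (hx e he).1

open Classical in
-- Follow the line `x + t v`. When it crosses a side, the indicator of `T` changes by `-sign(n_e ·
-- v)`, and the indicator of the shadow of that side drops from 1 to 0. The two changes cancel, so
-- the difference `D` of the two sides of the identity is constant apart from the crossing points.
-- It is zero for large `t` because `T` is compact.
lemma FlatSided.indicator_eq_sum (h : FlatSided T S N) {v : Euc d} (hv : v ≠ 0) {x : Euc d}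
    (hx : x ∉ frontier T) (hline : ∀ e ∈ S, ∀ t : ℝ, x + t • v ∈ e →
      inner ℝ (N e) v ≠ 0 ∧ x + t • v ∈ intrinsicInterior ℝ e) :
    T.indicator (fun _ => (1 : ℝ)) x =
      ∑ e ∈ S, SignType.sign (inner ℝ (N e) v) * (shadow v e).indicator (fun _ => (1 : ℝ)) x := by
  set X : ℝ → Euc d := fun t => x + t • v with hX
  have hXc : Continuous X := by fun_prop
  have hXsub : ∀ s t, X s - X t = (s - t) • v := fun s t => by
    simp only [hX, sub_smul]; abel
  have hshadow : ∀ e t, X t ∈ shadow v e ↔ ∃ u, t < u ∧ X u ∈ e := fun e t => by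
    constructor
    · rintro ⟨u, hu, hm⟩
      refine ⟨t + u, by linarith, ?_⟩
      simpa only [hX, add_smul, add_assoc] using hm
    · rintro ⟨u, hu, hm⟩
      refine ⟨u - t, by linarith, ?_⟩
      have : X t + (u - t) • v = X u := by rw [← hXsub]; abel
      rwa [this]
  have huniq : ∀ e ∈ S, ∀ s t, X s ∈ e → X t ∈ e → s = t := fun e he s t hs ht => by
    have h1 := (h.normal e he).2.1 _ ht _ hs
    rw [hXsub, inner_smul_right] at h1
    linarith [(mul_eq_zero.1 h1).resolve_right (hline e he t ht).1]
  -- away from the side, the indicator of the shadow is locally constant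
  have hconst : ∀ e ∈ S, ∀ t, X t ∉ e → ∀ᶠ s in 𝓝 t,
      (shadow v e).indicator (fun _ => (1 : ℝ)) (X s) =
        (shadow v e).indicator (fun _ => (1 : ℝ)) (X t) := fun e he t ht => by
    have hev : ∀ᶠ s in 𝓝 t, (X s ∈ shadow v e ↔ X t ∈ shadow v e) := by
      simp only [hshadow]
      by_cases hex : ∃ u, X u ∈ e
      · obtain ⟨u, hu⟩ := hex
        have h1 : ∀ s, (∃ w, s < w ∧ X w ∈ e) ↔ s < u := fun s =>
          ⟨fun ⟨w, hw, hm⟩ => huniq e he w u hm hu ▸ hw, fun hs => ⟨u, hs, hu⟩⟩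
        simp only [h1]
        have hne : t ≠ u := fun h0 => ht (h0 ▸ hu)
        rcases lt_or_gt_of_ne hne with hlt | hgt
        · filter_upwards [gt_mem_nhds hlt] with s hs using by simp [hs, hlt]
        · filter_upwards [lt_mem_nhds hgt] with s hs using by
            simp [not_lt.2 hs.le, not_lt.2 hgt.le]
      · exact Eventually.of_forall fun s =>
          ⟨fun ⟨w, _, hm⟩ => absurd ⟨w, hm⟩ hex, fun ⟨w, _, hm⟩ => absurd ⟨w, hm⟩ hex⟩
    filter_upwards [hev] with s hs
    simp only [Set.indicator_apply, hs]
  set D : ℝ → ℝ := fun t => T.indicator (fun _ => (1 : ℝ)) (X t) -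
    ∑ e ∈ S, SignType.sign (inner ℝ (N e) v) * (shadow v e).indicator (fun _ => (1 : ℝ)) (X t)
    with hD
  have hgood : ∀ t, X t ∉ frontier T → ∀ᶠ s in 𝓝 t, D s = D t := fun t ht => by
    have h1 : ∀ᶠ s in 𝓝 t, (X s ∈ T ↔ X t ∈ T) := by
      have : X t ∈ interior T ∪ interior Tᶜ := by
        rw [← compl_frontier_eq_union_interior]; exact ht
      rcases this with hm | hm
      · filter_upwards [hXc.continuousAt.preimage_mem_nhds (mem_interior_iff_mem_nhds.1 hm)]
          with s hs
        exact ⟨fun _ => interior_subset hm, fun _ => hs⟩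
      · filter_upwards [hXc.continuousAt.preimage_mem_nhds (mem_interior_iff_mem_nhds.1 hm)]
          with s hs
        exact ⟨fun h0 => absurd h0 hs, fun h0 => absurd h0 (interior_subset hm)⟩
    have h2 : ∀ᶠ s in 𝓝 t, ∀ e ∈ S, (shadow v e).indicator (fun _ => (1 : ℝ)) (X s) =
        (shadow v e).indicator (fun _ => (1 : ℝ)) (X t) := by
      rw [Finset.eventually_all]
      refine fun e he => hconst e he t fun h0 => ht ?_
      rw [h.frontier_eq]
      exact Set.mem_biUnion (t := fun e => e) he h0
    filter_upwards [h1, h2] with s hs hs'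
    simp only [hD]
    congr 1
    · simp only [Set.indicator_apply, hs]
    · exact Finset.sum_congr rfl fun e he => by rw [hs' e he]
  have hmain : D 0 = 0 := by
    refine eq_zero_of_eventually_const (fun t => ?_) ?_ (hgood 0 (by simpa [hX] using hx))
    · by_cases ht : X t ∈ frontier T
      · rw [h.frontier_eq] at ht
        obtain ⟨e, he, hte⟩ := Set.mem_iUnion₂.1 ht
        obtain ⟨hc, hint⟩ := hline e he t hte
        -- By genericity every crossing is in a relative interior, and these are disjoint; so a
        -- single side passes through `X t`, and near it the boundary of `T` lies in `e`.
        have hother : ∀ e' ∈ S, e' ≠ e → X t ∉ e' := fun e' he' hne ht' =>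
          Set.disjoint_left.1 (h.disjoint e' he' e he hne) (hline e' he' t ht').2 hint
        have hU : (⋃ e' ∈ S.erase e, e')ᶜ ∈ 𝓝 (X t) := by
          refine IsOpen.mem_nhds (isOpen_compl_iff.2 (isClosed_biUnion_finset fun e' he' =>
            (h.polytope e' (Finset.mem_of_mem_erase he')).compact.isClosed)) ?_
          simp only [Set.mem_compl_iff, Set.mem_iUnion, not_exists]
          exact fun e' he' => hother e' (Finset.mem_of_mem_erase he') (Finset.ne_of_mem_erase he')
        have hhalf := (h.normal e he).half_ball hint hU (fun y hy => by
          have hy2 := hy.2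
          rw [h.frontier_eq] at hy2
          obtain ⟨e', he', hye'⟩ := Set.mem_iUnion₂.1 hy2
          by_cases hee : e' = e
          · exact hee ▸ hye'
          · exact absurd (Set.mem_biUnion (t := fun e => e) (Finset.mem_erase.2 ⟨hee, he'⟩) hye')
              hy.1)
        have hhalf' := hXc.continuousAt.eventually hhalf
        have h2 : ∀ᶠ s in 𝓝 t, ∀ e' ∈ S.erase e,
            (shadow v e').indicator (fun _ => (1 : ℝ)) (X s) =
              (shadow v e').indicator (fun _ => (1 : ℝ)) (X t) := by
          rw [Finset.eventually_all]
          exact fun e' he' => hconst e' (Finset.mem_of_mem_erase he') t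
            (hother e' (Finset.mem_of_mem_erase he') (Finset.ne_of_mem_erase he'))
        -- The combined contribution of `T` and `e` is the same on both sides of the crossing: `1 -
        -- 1 = 0 - 0` if the line leaves `T`, and `0 - (-1) = 1 - 0` if it enters.
        refine ⟨(if 0 < inner ℝ (N e) v then 0 else 1) - ∑ e' ∈ S.erase e,
          SignType.sign (inner ℝ (N e') v) * (shadow v e').indicator (fun _ => (1 : ℝ)) (X t), ?_⟩
        rw [eventually_nhdsWithin_iff]
        filter_upwards [hhalf', h2] with s hs hs' hst
        have hsh : X s ∈ shadow v e ↔ s < t := by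
          rw [hshadow]
          exact ⟨fun ⟨w, hw, hm⟩ => huniq e he w t hm hte ▸ hw, fun hs => ⟨t, hs, hte⟩⟩
        rw [hXsub, inner_smul_right] at hs
        simp only [hD]
        rw [← Finset.add_sum_erase S _ he, Finset.sum_congr rfl fun e' he' => by rw [hs' e' he'],
          ← sub_sub]
        congr 1
        rcases lt_or_gt_of_ne (show s ≠ t from hst) with hlt | hgt
        · rcases lt_or_gt_of_ne hc with hneg | hpos
          · have hT : X s ∉ T := hs.2 (mul_pos_of_neg_of_neg (by linarith) hneg)
            simp [hT, hsh, hlt, sign_neg hneg, not_lt.2 hneg.le]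
          · have hT : X s ∈ T := hs.1 (mul_neg_of_neg_of_pos (by linarith) hpos)
            simp [hT, hsh, hlt, sign_pos hpos, hpos]
        · rcases lt_or_gt_of_ne hc with hneg | hpos
          · have hT : X s ∈ T := hs.1 (mul_neg_of_pos_of_neg (by linarith) hneg)
            simp [hT, hsh, not_lt.2 hgt.le, not_lt.2 hneg.le]
          · have hT : X s ∉ T := hs.2 (mul_pos (by linarith) hpos)
            simp [hT, hsh, not_lt.2 hgt.le, hpos]
      · exact ⟨D t, eventually_nhdsWithin_of_eventually_nhds (hgood t ht)⟩
    · have hcl : Topology.IsClosedEmbedding X :=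
        (Homeomorph.addLeft x).isClosedEmbedding.comp (isClosedEmbedding_smul_left hv)
      obtain ⟨R, hR⟩ := (hcl.isCompact_preimage h.compact).bddAbove
      filter_upwards [eventually_gt_atTop R] with s hs
      have h1 : ∀ u, s ≤ u → X u ∉ T := fun u hu hm => absurd (hR hm) (by linarith)
      have h2 : ∀ e ∈ S, X s ∉ shadow v e := fun e he hm => by
        obtain ⟨u, hu, hm⟩ := (hshadow e s).1 hm
        exact h1 u hu.le (h.subset he hm)
      simp only [hD]
      rw [Set.indicator_of_notMem (h1 s le_rfl), Finset.sum_eq_zero, sub_zero]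
      intro e he
      rw [Set.indicator_of_notMem (h2 e he), mul_zero]
  have hX0 : X 0 = x := by simp [hX]
  simp only [hD, hX0] at hmain
  exact sub_eq_zero.1 hmain

/-- The divergence theorem, for compactly supported functions. -/
lemma FlatSided.integral_fderiv_of_hasCompactSupport (h : FlatSided T S N) (hd : 1 ≤ d)
    (v : Euc d) {f : Euc d → ℝ} (hf : ContDiff ℝ 1 f) (hf' : HasCompactSupport f) :
    ∫ x in T, fderiv ℝ f x v = ∑ e ∈ S, inner ℝ (N e) v * ∫ x in e, f x ∂(surf d) := by
  by_cases hv : v = 0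
  · simp [hv]
  have hgi : Integrable (fun x => fderiv ℝ f x v) volume :=
    ((hf.continuous_fderiv one_ne_zero).clm_apply continuous_const).integrable_of_hasCompactSupport
      ((hf'.fderiv (𝕜 := ℝ)).comp_left (g := fun L : Euc d →L[ℝ] ℝ => L v) rfl)
  have hm : ∀ e ∈ S, inner ℝ (N e) v ≠ 0 → MeasurableSet (shadow v e) := fun e he hc => by
    obtain ⟨p, hp, hsub⟩ := h.hyperplane he
    exact measurableSet_shadow hc hsub (h.polytope e he).compact.measurableSet
  have h1 : ∀ᵐ x : Euc d, T.indicator (fun x => fderiv ℝ f x v) x =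
      ∑ e ∈ S, SignType.sign (inner ℝ (N e) v) *
        (shadow v e).indicator (fun x => fderiv ℝ f x v) x := by
    filter_upwards [h.ae_good hd v] with x hx
    have h2 := h.indicator_eq_sum hv hx.1 hx.2
    have h3 : ∀ s : Set (Euc d), s.indicator (fun x => fderiv ℝ f x v) x =
        s.indicator (fun _ => (1 : ℝ)) x * fderiv ℝ f x v := fun s => by
      by_cases hs : x ∈ s <;> simp [hs]
    rw [h3, h2, Finset.sum_mul]
    exact Finset.sum_congr rfl fun e _ => by rw [h3, mul_assoc]
  rw [← integral_indicator h.compact.measurableSet, integral_congr_ae h1, integral_finsetSum]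
  · refine Finset.sum_congr rfl fun e he => ?_
    rw [integral_const_mul]
    by_cases hc : inner ℝ (N e) v = 0
    · simp [hc]
    · obtain ⟨p, hp, hsub⟩ := h.hyperplane he
      rw [integral_indicator (hm e he hc), setIntegral_shadow (h.normal e he).1 hc hsub
        (h.polytope e he).compact.measurableSet hf hf', ← mul_assoc, sign_mul_abs]
  · intro e he
    by_cases hc : inner ℝ (N e) v = 0
    · simp [hc]
    · exact (hgi.indicator (hm e he hc)).const_mul _

/-- The divergence theorem. -/
lemma FlatSided.integral_fderiv (h : FlatSided T S N) (hd : 1 ≤ d)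
    (v : Euc d) {f : Euc d → ℝ} (hf : ContDiff ℝ 1 f) :
    ∫ x in T, fderiv ℝ f x v = ∑ e ∈ S, inner ℝ (N e) v * ∫ x in e, f x ∂(surf d) := by
  obtain ⟨R, hR0, hR⟩ := h.compact.isBounded.subset_ball_lt 0 (0 : Euc d)
  -- A cutoff equal to 1 near every point of `T` changes neither the derivative on `T` nor the
  -- values on the sides.
  let χ : ContDiffBump (0 : Euc d) := ⟨R, R + 1, hR0, by linarith⟩
  have hχ : ∀ x ∈ T, (fun x => χ x * f x) =ᶠ[𝓝 x] f := fun x hx => by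
    filter_upwards [Metric.isOpen_ball.mem_nhds (hR hx)] with y hy
    rw [χ.one_of_mem_closedBall (Metric.ball_subset_closedBall hy), one_mul]
  have h1 := h.integral_fderiv_of_hasCompactSupport hd v (f := fun x => χ x * f x)
    (χ.contDiff.mul hf) χ.hasCompactSupport.mul_right
  rw [setIntegral_congr_fun h.compact.measurableSet
    (g := fun x => fderiv ℝ f x v) fun x hx => by
      simp only [(hχ x hx).fderiv_eq]] at h1
  rw [h1]
  refine Finset.sum_congr rfl fun e he => ?_
  congr 1
  exact setIntegral_congr_fun (h.polytope e he).compact.measurableSet fun x hx =>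
    (hχ x (h.subset he hx)).eq_of_nhds

end WG

namespace WG

/-! ### Polynomials -/

section IsPoly

variable {d r s : ℕ} {f g : Euc d → ℝ}

lemma isPoly_const (r : ℕ) (a : ℝ) : IsPoly r (fun _ : Euc d => a) :=
  ⟨MvPolynomial.C a, by simp, by simp⟩

lemma IsPoly.mono (hf : IsPoly r f) (h : r ≤ s) : IsPoly s f := by
  obtain ⟨p, hp, hpf⟩ := hf
  exact ⟨p, hp.trans h, hpf⟩

lemma IsPoly.add (hf : IsPoly r f) (hg : IsPoly r g) : IsPoly r (fun x => f x + g x) := by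
  obtain ⟨p, hp, hpf⟩ := hf
  obtain ⟨q, hq, hqg⟩ := hg
  exact ⟨p + q, (MvPolynomial.totalDegree_add p q).trans (max_le hp hq),
    fun x => by simp only [hpf, hqg, map_add]⟩

lemma IsPoly.const_mul (hf : IsPoly r f) (a : ℝ) : IsPoly r (fun x => a * f x) := by
  obtain ⟨p, hp, hpf⟩ := hf
  refine ⟨a • p, (MvPolynomial.totalDegree_smul_le a p).trans hp, fun x => ?_⟩
  simp only [hpf, MvPolynomial.smul_eval]

lemma IsPoly.sub (hf : IsPoly r f) (hg : IsPoly r g) : IsPoly r (fun x => f x - g x) := by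
  simpa [sub_eq_add_neg] using hf.add (hg.const_mul (-1))

lemma IsPoly.contDiff (hf : IsPoly r f) : ContDiff ℝ 1 f := by
  obtain ⟨p, -, hpf⟩ := hf
  rw [show f = _ from funext hpf]
  exact (AnalyticOnNhd.eval_continuousLinearMap'
    (fun i => (EuclideanSpace.proj i : Euc d →L[ℝ] ℝ)) p).contDiff

lemma IsPoly.continuous (hf : IsPoly r f) : Continuous f := hf.contDiff.continuous

lemma IsPoly.differentiable (hf : IsPoly r f) : Differentiable ℝ f :=
  hf.contDiff.differentiable one_ne_zero

lemma pd_eval (j : Fin d) (p : MvPolynomial (Fin d) ℝ) (x : Euc d) :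
    pd j (fun y : Euc d => MvPolynomial.eval (fun i => y i) p) x =
      MvPolynomial.eval (fun i => x i) (MvPolynomial.pderiv j p) := by
  have hdiff : ∀ q : MvPolynomial (Fin d) ℝ,
      Differentiable ℝ (fun y : Euc d => MvPolynomial.eval (fun i => y i) q) := fun q =>
    IsPoly.differentiable ⟨q, le_rfl, fun _ => rfl⟩
  induction p using MvPolynomial.induction_on with
  | C a => simp [pd]
  | add p q hp hq =>
    simp only [pd, map_add] at hp hq ⊢
    rw [fderiv_fun_add (hdiff p x) (hdiff q x), add_apply, hp, hq]
  | mul_X p i hp =>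
    simp only [pd, map_mul, MvPolynomial.eval_X, Derivation.leibniz, smul_eq_mul, map_add,
      MvPolynomial.pderiv_X] at hp ⊢
    have hproj : HasFDerivAt (fun y : Euc d => y i) (EuclideanSpace.proj i : Euc d →L[ℝ] ℝ) x :=
      (EuclideanSpace.proj i : Euc d →L[ℝ] ℝ).hasFDerivAt
    rw [fderiv_fun_mul (hdiff p x) hproj.differentiableAt, hproj.fderiv]
    simp only [add_apply, smul_apply, smul_eq_mul, hp, Pi.single_apply]
    by_cases hij : i = j
    · subst hij; simp
    · simp [hij]

lemma totalDegree_pderiv_le (j : Fin d) (p : MvPolynomial (Fin d) ℝ) :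
    (MvPolynomial.pderiv j p).totalDegree ≤ p.totalDegree - 1 := by
  conv_lhs => rw [p.as_sum, map_sum]
  refine MvPolynomial.totalDegree_finsetSum_le fun m hm => ?_
  rw [MvPolynomial.pderiv_monomial]
  by_cases hj : m j = 0
  · simp [hj]
  · refine (MvPolynomial.totalDegree_monomial_le _ _).trans ?_
    have h1 := MvPolynomial.le_totalDegree hm
    have h2 : (m - Finsupp.single j 1) + Finsupp.single j 1 = m :=
      tsub_add_cancel_of_le (Finsupp.single_le_iff.2 (Nat.one_le_iff_ne_zero.2 hj))
    have h3 : Finsupp.degree (m - Finsupp.single j 1) + 1 = Finsupp.degree m := by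
      conv_rhs => rw [← h2]
      rw [map_add, Finsupp.degree_single]
    have h4 : ∀ s : Fin d →₀ ℕ, (s.sum fun _ e => e) = Finsupp.degree s := fun s => by
      simp [Finsupp.sum, Finsupp.degree_apply]
    rw [h4] at h1
    change ((m - Finsupp.single j 1).sum fun _ e => e) ≤ _
    rw [h4]
    omega

lemma IsPoly.pd (hf : IsPoly r f) (j : Fin d) : IsPoly (r - 1) (pd j f) := by
  obtain ⟨p, hp, hpf⟩ := hf
  refine ⟨MvPolynomial.pderiv j p, (totalDegree_pderiv_le j p).trans (by omega), fun x => ?_⟩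
  rw [← pd_eval, ← show f = _ from funext hpf]

lemma IsPoly.exists_polynomial (hf : IsPoly r f) (A w : Euc d) :
    ∃ q : Polynomial ℝ, q.natDegree ≤ r ∧ ∀ t : ℝ, q.eval t = f (A + t • w) := by
  obtain ⟨p, hp, hpf⟩ := hf
  refine ⟨MvPolynomial.aeval (fun i => Polynomial.C (A i) + Polynomial.X * Polynomial.C (w i)) p,
    ?_, fun t => ?_⟩
  · refine (MvPolynomial.aeval_natDegree_le p hp _ (n := 1) fun i => ?_).trans (by simp)
    compute_degree
  · rw [hpf, MvPolynomial.aeval_def, MvPolynomial.polynomial_eval_eval₂, ← MvPolynomial.eval₂_id]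
    congr 1
    · ext a; simp
    · ext i; simp; ring

end IsPoly

/-- The space of polynomials of degree at most `r`. -/
def polySub (d r : ℕ) : Submodule ℝ (Euc d → ℝ) where
  carrier := {f | IsPoly r f}
  add_mem' hf hg := IsPoly.add hf hg
  zero_mem' := isPoly_const r 0
  smul_mem' a _ hf := IsPoly.const_mul hf a

instance (d r : ℕ) : FiniteDimensional ℝ (polySub d r) := by
  let φ : MvPolynomial.restrictTotalDegree (Fin d) ℝ r →ₗ[ℝ] polySub d r :=
    { toFun := fun p => ⟨fun x => MvPolynomial.eval (fun i => x i) p.1, p.1,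
        (MvPolynomial.mem_restrictTotalDegree _ _ _).1 p.2, fun _ => rfl⟩
      map_add' := fun p q => by ext x; simp
      map_smul' := fun a p => by ext x; simp [MvPolynomial.smul_eval] }
  refine Module.Finite.of_surjective φ ?_
  rintro ⟨f, p, hp, hpf⟩
  exact ⟨⟨p, (MvPolynomial.mem_restrictTotalDegree _ _ _).2 hp⟩, by ext x; exact (hpf x).symm⟩

/-! ### Representation of linear functionals -/

/-- A linear functional on a finite-dimensional space that vanishes on the isotropic vectors of a
symmetric bilinear form is represented by a vector. -/
lemma exists_representer {W : Type*} [AddCommGroup W] [Module ℝ W] [FiniteDimensional ℝ W]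
    (B : W →ₗ[ℝ] W →ₗ[ℝ] ℝ) (hB : ∀ x y, B x y = B y x) (L : W →ₗ[ℝ] ℝ)
    (hL : ∀ w, B w w = 0 → L w = 0) : ∃ G, ∀ φ, B G φ = L φ := by
  -- No definiteness is needed: vectors in the kernel of `B` are isotropic, so `L` annihilates the
  -- kernel and lies in the range of the transpose of `B`. Reflexivity turns the preimage into a
  -- vector of `W`.
  have h1 : L ∈ B.ker.dualAnnihilator := by
    rw [Submodule.mem_dualAnnihilator]
    intro w hw
    refine hL w ?_
    rw [LinearMap.mem_ker.1 hw]
    rfl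
  rw [← LinearMap.range_dualMap_eq_dualAnnihilator_ker] at h1
  obtain ⟨ψ, hψ⟩ := h1
  obtain ⟨G, rfl⟩ := (Module.evalEquiv ℝ W).surjective ψ
  refine ⟨G, fun φ => ?_⟩
  rw [← hψ, hB]
  rfl

/-- Cauchy–Schwarz, from nonnegativity of the form at `t G - φ` with `t = B G φ / (B G G + 1)`. The
added 1 keeps the constant positive even when `G` is isotropic. -/
lemma sq_le_of_representer {W : Type*} [AddCommGroup W] [Module ℝ W]
    (B : W →ₗ[ℝ] W →ₗ[ℝ] ℝ) (hB : ∀ x y, B x y = B y x) (hpos : ∀ x, 0 ≤ B x x) (G φ : W) :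
    (B G φ) ^ 2 ≤ (B G G + 1) * B φ φ := by
  have hC : 0 < B G G + 1 := by linarith [hpos G]
  have h := hpos ((B G φ / (B G G + 1)) • G - φ)
  simp only [map_sub, map_smul, LinearMap.sub_apply, LinearMap.smul_apply, smul_eq_mul, hB φ G] at h
  set b := B G φ
  set C := B G G + 1 with hCdef
  have hGG : B G G = C - 1 := by rw [hCdef]; ring
  rw [hGG] at h
  have h2 : b / C * (b / C * (C - 1) - b) - (b / C * b - B φ φ) =
      B φ φ - b ^ 2 / C - (b / C) ^ 2 := by field_simp; ring
  have h3 : b ^ 2 / C ≤ B φ φ := by nlinarith [sq_nonneg (b / C)]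
  rwa [div_le_iff₀ hC, mul_comm] at h3

end WG

namespace WG

/-! ### The trace inequality -/

/-- The weighted `L²(0,1)` inner product of real polynomials. -/
def weightedForm (m : ℕ) : Polynomial ℝ →ₗ[ℝ] Polynomial ℝ →ₗ[ℝ] ℝ :=
  LinearMap.mk₂ ℝ (fun p q => ∫ t in (0 : ℝ)..1, t ^ m * (p.eval t * q.eval t))
    (fun p p' q => by
      rw [← intervalIntegral.integral_add (Continuous.intervalIntegrable (by fun_prop) _ _)
        (Continuous.intervalIntegrable (by fun_prop) _ _)]
      congr 1; ext t; rw [Polynomial.eval_add]; ring)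
    (fun a p q => by
      rw [smul_eq_mul, ← intervalIntegral.integral_const_mul]
      congr 1; ext t; rw [Polynomial.eval_smul, smul_eq_mul]; ring)
    (fun p q q' => by
      rw [← intervalIntegral.integral_add (Continuous.intervalIntegrable (by fun_prop) _ _)
        (Continuous.intervalIntegrable (by fun_prop) _ _)]
      congr 1; ext t; rw [Polynomial.eval_add]; ring)
    (fun a p q => by
      rw [smul_eq_mul, ← intervalIntegral.integral_const_mul]
      congr 1; ext t; rw [Polynomial.eval_smul, smul_eq_mul]; ring)

/-- Evaluation at 1 is a linear functional on a finite-dimensional space, so it is represented in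
the weighted `L²(0,1)` form; the constant depends on `m` and `r` alone. A polynomial with nonzero
value at 1 has positive norm by continuity. -/
lemma exists_eval_one_sq_le (m r : ℕ) : ∃ C : ℝ, 0 < C ∧ ∀ q : Polynomial ℝ, q.natDegree ≤ r →
    q.eval 1 ^ 2 ≤ C * ∫ t in (0 : ℝ)..1, t ^ m * (q.eval t) ^ 2 := by
  let W := Polynomial.degreeLT ℝ (r + 1)
  have : FiniteDimensional ℝ W := Module.Finite.equiv (Polynomial.degreeLTEquiv ℝ (r + 1)).symm
  let B : W →ₗ[ℝ] W →ₗ[ℝ] ℝ := (weightedForm m).compl₁₂ W.subtype W.subtype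
  have hBa : ∀ x y : W, B x y = ∫ t in (0 : ℝ)..1, t ^ m * (x.1.eval t * y.1.eval t) :=
    fun x y => rfl
  have hB : ∀ x y, B x y = B y x := fun x y => by simp only [hBa, mul_comm]
  have hnn : ∀ x : W, ∀ t ∈ Set.Ioc (0 : ℝ) 1, 0 ≤ t ^ m * (x.1.eval t * x.1.eval t) :=
    fun x t ht => mul_nonneg (pow_nonneg ht.1.le _) (mul_self_nonneg _)
  have hpos : ∀ x, 0 ≤ B x x := fun x => by
    rw [hBa, intervalIntegral.integral_of_le zero_le_one]
    exact setIntegral_nonneg measurableSet_Ioc (hnn x)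
  let L : W →ₗ[ℝ] ℝ := (Polynomial.leval (1 : ℝ)).comp W.subtype
  obtain ⟨G, hG⟩ := exists_representer B hB L fun w hw => by
    by_contra h0
    have h1 := intervalIntegral.integral_pos (a := (0 : ℝ)) (b := 1) one_pos
      (f := fun t => t ^ m * (w.1.eval t * w.1.eval t)) (by fun_prop) (hnn w)
      ⟨1, by simp, by rw [one_pow, one_mul]; exact mul_self_pos.2 h0⟩
    rw [hBa] at hw
    exact h1.ne' hw
  refine ⟨B G G + 1, by linarith [hpos G], fun q hq => ?_⟩
  have hqW : q ∈ W := by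
    rw [Polynomial.mem_degreeLT]
    exact (Polynomial.degree_le_natDegree).trans_lt (by exact_mod_cast Nat.lt_succ_of_le hq)
  have h := sq_le_of_representer B hB hpos G ⟨q, hqW⟩
  rw [hG, hBa ⟨q, hqW⟩] at h
  simp only [sq] at h ⊢
  exact h

/-- The trace inequality for polynomials, on a set that contains a pyramid over `e`. -/
lemma exists_trace_inequality (d r : ℕ) : ∃ C : ℝ, 0 < C ∧ ∀ (T e : Set (Euc d)) (n A : Euc d)
    (H : ℝ), ‖n‖ = 1 → 0 < H → IsCompact T → IsCompact e →
    (∀ x ∈ e, inner ℝ n (x - A) = H) → (∀ y ∈ e, ∀ t ∈ Set.Ioo (0 : ℝ) 1, A + t • (y - A) ∈ T) →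
    ∀ f : Euc d → ℝ, IsPoly r f → H * ∫ x in e, f x ^ 2 ∂(surf d) ≤ C * ∫ x in T, f x ^ 2 := by
  obtain ⟨C, hC, hCq⟩ := exists_eval_one_sq_le (d - 1) r
  refine ⟨C, hC, fun T e n A H hn hH hT he hbase hcone f hf => ?_⟩
  have hfc := hf.continuous
  -- The one-variable bound on the segment from the apex to `y`, where `t = 1` is `y` itself. The
  -- weight `t ^ (d - 1)` is the Jacobian of the cone.
  have hpt : ∀ y : Euc d, ENNReal.ofReal (f y ^ 2) ≤ ENNReal.ofReal C *
      ∫⁻ t in Set.Ioo (0 : ℝ) 1, ENNReal.ofReal (t ^ (d - 1)) *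
        ENNReal.ofReal (f (A + t • (y - A)) ^ 2) := fun y => by
    obtain ⟨q, hq, hqf⟩ := hf.exists_polynomial A (y - A)
    have h1 := hCq q hq
    simp only [hqf, one_smul, add_sub_cancel] at h1
    rw [intervalIntegral.integral_of_le zero_le_one, integral_Ioc_eq_integral_Ioo] at h1
    refine (ENNReal.ofReal_le_ofReal h1).trans (le_of_eq ?_)
    have hcont : Continuous fun t : ℝ => t ^ (d - 1) * f (A + t • (y - A)) ^ 2 := by fun_prop
    rw [ENNReal.ofReal_mul hC.le, ofReal_integral_eq_lintegral_ofReal]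
    · congr 1
      refine setLIntegral_congr_fun measurableSet_Ioo fun t ht => ?_
      rw [ENNReal.ofReal_mul (pow_nonneg ht.1.le _)]
    · exact (hcont.integrableOn_Icc (a := 0) (b := 1)).mono_set Set.Ioo_subset_Icc_self
    · exact (ae_restrict_iff' measurableSet_Ioo).2 (Filter.Eventually.of_forall fun t ht =>
        mul_nonneg (pow_nonneg ht.1.le _) (sq_nonneg _))
  have hF : Measurable fun x => ENNReal.ofReal (f x ^ 2) := by fun_prop
  have h2 := lintegral_cone_le hn hH hbase he.measurableSet hT.measurableSet hcone hF
  have hint : IntegrableOn (fun x => f x ^ 2) T :=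
    (hfc.pow 2).continuousOn.integrableOn_compact hT
  have h3 : ENNReal.ofReal H * ∫⁻ x in e, ENNReal.ofReal (f x ^ 2) ∂(surf d) ≤
      ENNReal.ofReal (C * ∫ x in T, f x ^ 2) := by
    rw [ENNReal.ofReal_mul hC.le, ofReal_integral_eq_lintegral_ofReal hint
      (Filter.Eventually.of_forall fun x => sq_nonneg _)]
    refine le_trans ?_ (mul_le_mul_right h2 _)
    rw [mul_left_comm]
    refine mul_le_mul_right ?_ _
    rw [← lintegral_const_mul' _ _ ENNReal.ofReal_ne_top]
    exact lintegral_mono fun y => hpt y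
  have hT0 : 0 ≤ C * ∫ x in T, f x ^ 2 :=
    mul_nonneg hC.le (integral_nonneg fun x => sq_nonneg _)
  have h4 := ENNReal.toReal_mono ENNReal.ofReal_ne_top h3
  rw [ENNReal.toReal_mul, ENNReal.toReal_ofReal hH.le, ENNReal.toReal_ofReal hT0] at h4
  rwa [integral_eq_lintegral_of_nonneg_ae (Filter.Eventually.of_forall fun x => sq_nonneg _)
    (by fun_prop)]

end WG

namespace WG

/-! ### Inner products on elements and sides -/

variable {d : ℕ}

lemma integrableOn_surf {n p : Euc d} (hn : ‖n‖ = 1) {e : Set (Euc d)}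
    (he : e ⊆ {x | inner ℝ n (x - p) = 0}) (hc : IsCompact e) {f : Euc d → ℝ}
    (hf : ContinuousOn f e) : IntegrableOn f e (surf d) := by
  obtain ⟨C, hC⟩ := hc.exists_bound_of_continuousOn hf
  have : IsFiniteMeasure ((surf d).restrict e) := ⟨by simpa using surf_lt_top hn he hc⟩
  exact Integrable.of_bound (hf.aestronglyMeasurable hc.measurableSet) C
    ((ae_restrict_iff' hc.measurableSet).2 (Filter.Eventually.of_forall hC))

/-- A compact piece of a hyperplane. -/
structure IsFlat (e : Set (Euc d)) : Prop where
  compact : IsCompact e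
  flat : ∃ n p : Euc d, ‖n‖ = 1 ∧ e ⊆ {x | inner ℝ n (x - p) = 0}

lemma IsFlat.integrableOn {e : Set (Euc d)} (he : IsFlat e) {f : Euc d → ℝ}
    (hf : ContinuousOn f e) : IntegrableOn f e (surf d) := by
  obtain ⟨n, p, hn, hp⟩ := he.flat
  exact integrableOn_surf hn hp he.compact hf

lemma IsFlat.integrableOn_inner {e : Set (Euc d)} (he : IsFlat e) {f g : Euc d → Euc d}
    (hf : ContinuousOn f e) (hg : ContinuousOn g e) :
    IntegrableOn (fun x => inner ℝ (f x) (g x)) e (surf d) :=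
  he.integrableOn (hf.inner hg)

lemma ipSide_comm (e : Set (Euc d)) (f g : Euc d → Euc d) : ipSide e f g = ipSide e g f := by
  simp only [ipSide, real_inner_comm]

lemma ipSide_congr {e : Set (Euc d)} (he : IsFlat e) {f f' g g' : Euc d → Euc d}
    (hf : ∀ x ∈ e, f x = f' x) (hg : ∀ x ∈ e, g x = g' x) : ipSide e f g = ipSide e f' g' :=
  setIntegral_congr_fun he.compact.measurableSet fun x hx => by
    simp only [hf x hx, hg x hx]

lemma ipSide_add_right {e : Set (Euc d)} (he : IsFlat e) {f g g' : Euc d → Euc d}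
    (hf : ContinuousOn f e) (hg : ContinuousOn g e) (hg' : ContinuousOn g' e) :
    ipSide e f (fun x => g x + g' x) = ipSide e f g + ipSide e f g' := by
  simp only [ipSide, inner_add_right]
  exact integral_add (he.integrableOn_inner hf hg) (he.integrableOn_inner hf hg')

lemma ipSide_smul_right (e : Set (Euc d)) (f g : Euc d → Euc d) (a : ℝ) :
    ipSide e f (fun x => a • g x) = a * ipSide e f g := by
  simp only [ipSide, inner_smul_right, integral_const_mul]

lemma ipSide_sub_left {e : Set (Euc d)} (he : IsFlat e) {f f' g : Euc d → Euc d}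
    (hf : ContinuousOn f e) (hf' : ContinuousOn f' e) (hg : ContinuousOn g e) :
    ipSide e (fun x => f x - f' x) g = ipSide e f g - ipSide e f' g := by
  simp only [ipSide, inner_sub_left]
  exact integral_sub (he.integrableOn_inner hf hg) (he.integrableOn_inner hf' hg)

lemma ipSide_self_nonneg (e : Set (Euc d)) (f : Euc d → Euc d) : 0 ≤ ipSide e f f :=
  integral_nonneg fun _ => real_inner_self_nonneg

/-- A continuous field of zero norm vanishes almost everywhere. This is the isotropy condition of
`exists_representer`, and it does not ask that `e` have positive area. -/
lemma ipSide_eq_zero_of_self {e : Set (Euc d)} (he : IsFlat e) (f : Euc d → Euc d)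
    {g : Euc d → Euc d} (hg : ContinuousOn g e) (h : ipSide e g g = 0) : ipSide e f g = 0 := by
  have h1 := (setIntegral_eq_zero_iff_of_nonneg_ae
    (Filter.Eventually.of_forall fun x => real_inner_self_nonneg)
    (he.integrableOn_inner hg hg)).1 h
  refine integral_eq_zero_of_ae ?_
  filter_upwards [h1] with x hx
  have : g x = 0 := inner_self_eq_zero.1 hx
  simp [this]

/-- Young's inequality on a side. -/
lemma neg_ipSide_le {e : Set (Euc d)} (he : IsFlat e) {f g : Euc d → Euc d}
    (hf : ContinuousOn f e) (hg : ContinuousOn g e) {a : ℝ} (ha : 0 < a) :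
    -ipSide e f g ≤ a / 2 * ipSide e f f + 1 / (2 * a) * ipSide e g g := by
  simp only [ipSide]
  rw [← integral_neg, ← integral_const_mul, ← integral_const_mul,
    ← integral_add ((he.integrableOn_inner hf hf).const_mul _)
      ((he.integrableOn_inner hg hg).const_mul _)]
  refine integral_mono (he.integrableOn_inner hf hg).neg
    (((he.integrableOn_inner hf hf).const_mul _).add
      ((he.integrableOn_inner hg hg).const_mul _)) fun x => ?_
  -- The pointwise inequality is the expansion of `‖a f + g‖² ≥ 0`, divided by `2 a`.
  have h1 := real_inner_self_nonneg (x := a • f x + g x)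
  simp only [inner_add_left, inner_add_right, inner_smul_left, inner_smul_right,
    real_inner_comm (f x) (g x), conj_trivial] at h1
  have h2 : a / 2 * inner ℝ (f x) (f x) + 1 / (2 * a) * inner ℝ (g x) (g x) +
      inner ℝ (f x) (g x) = 1 / (2 * a) * (a * (a * inner ℝ (f x) (f x)) + a * inner ℝ (f x) (g x) +
        (a * inner ℝ (f x) (g x) + inner ℝ (g x) (g x))) := by
    field_simp
    ring
  have h3 : 0 ≤ 1 / (2 * a) * (a * (a * inner ℝ (f x) (f x)) + a * inner ℝ (f x) (g x) +
        (a * inner ℝ (f x) (g x) + inner ℝ (g x) (g x))) := by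
    refine mul_nonneg (by positivity) ?_
    convert! h1 using 1
    ring
  change -inner ℝ (f x) (g x) ≤ _
  linarith

/-- Continuity of the entries of a matrix-valued function. -/
def ContMat (A : Euc d → Matrix (Fin d) (Fin d) ℝ) : Prop := ∀ i j, Continuous fun x => A x i j

lemma IsPolyMat.contMat {r : ℕ} {A : Euc d → Matrix (Fin d) (Fin d) ℝ} (hA : IsPolyMat r A) :
    ContMat A := fun i j => (hA i j).continuous

lemma ContMat.frob {A B : Euc d → Matrix (Fin d) (Fin d) ℝ} (hA : ContMat A) (hB : ContMat B) :
    Continuous fun x => WG.frob (A x) (B x) :=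
  continuous_finsetSum _ fun i _ => continuous_finsetSum _ fun j _ => (hA i j).mul (hB i j)

lemma ContMat.integrableOn_frob {A B : Euc d → Matrix (Fin d) (Fin d) ℝ} (hA : ContMat A)
    (hB : ContMat B) {T : Set (Euc d)} (hT : IsCompact T) :
    IntegrableOn (fun x => WG.frob (A x) (B x)) T :=
  (hA.frob hB).continuousOn.integrableOn_compact hT

lemma ContMat.sub {A B : Euc d → Matrix (Fin d) (Fin d) ℝ} (hA : ContMat A) (hB : ContMat B) :
    ContMat fun x => A x - B x := fun i j => (hA i j).sub (hB i j)

lemma ContMat.continuous_apply {A : Euc d → Matrix (Fin d) (Fin d) ℝ} (hA : ContMat A)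
    (n : Euc d) : Continuous fun x => Matrix.toEuclideanLin (A x) n := by
  have h : Continuous A := continuous_matrix hA
  simp only [Matrix.toLpLin_apply]
  fun_prop

lemma frob_comm (A B : Matrix (Fin d) (Fin d) ℝ) : frob A B = frob B A := by
  simp only [frob, mul_comm]

lemma frob_add_right (A B C : Matrix (Fin d) (Fin d) ℝ) : frob A (B + C) = frob A B + frob A C := by
  simp only [frob, Matrix.add_apply, mul_add, Finset.sum_add_distrib]

lemma frob_sub_left (A B C : Matrix (Fin d) (Fin d) ℝ) : frob (A - B) C = frob A C - frob B C := by
  simp only [frob, Matrix.sub_apply, sub_mul, Finset.sum_sub_distrib]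

lemma frob_smul_right (A B : Matrix (Fin d) (Fin d) ℝ) (a : ℝ) : frob A (a • B) = a * frob A B := by
  simp only [frob, Matrix.smul_apply, smul_eq_mul, Finset.mul_sum, mul_left_comm]

lemma frob_smul_left (A B : Matrix (Fin d) (Fin d) ℝ) (a : ℝ) : frob (a • A) B = a * frob A B := by
  rw [frob_comm, frob_smul_right, frob_comm]

lemma frob_self_nonneg (A : Matrix (Fin d) (Fin d) ℝ) : 0 ≤ frob A A :=
  Finset.sum_nonneg fun _ _ => Finset.sum_nonneg fun _ _ => mul_self_nonneg _

lemma frob_transpose (A B : Matrix (Fin d) (Fin d) ℝ) : frob Aᵀ B = frob A Bᵀ := by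
  simp only [frob, Matrix.transpose_apply]
  exact Finset.sum_comm

/-- Only the symmetric part of `A` matters in the product with a symmetric matrix. -/
lemma frob_symm_part (A : Matrix (Fin d) (Fin d) ℝ) {B : Matrix (Fin d) (Fin d) ℝ} (hB : Bᵀ = B) :
    frob ((1 / 2 : ℝ) • (A + Aᵀ)) B = frob A B := by
  rw [frob_smul_left, frob_comm, frob_add_right, frob_comm B, frob_comm B, frob_transpose, hB]
  ring

lemma frob_self_le (A B : Matrix (Fin d) (Fin d) ℝ) :
    frob A A ≤ 2 * frob B B + 2 * frob (A - B) (A - B) := by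
  simp only [frob, Finset.mul_sum, ← Finset.sum_add_distrib]
  refine Finset.sum_le_sum fun i _ => Finset.sum_le_sum fun j _ => ?_
  rw [Matrix.sub_apply]
  nlinarith [sq_nonneg (2 * B i j - A i j)]

lemma inner_toEuclideanLin (u n : Euc d) (A : Matrix (Fin d) (Fin d) ℝ) :
    inner ℝ u (Matrix.toEuclideanLin A n) = ∑ i, ∑ j, u i * (A i j * n j) := by
  simp [PiLp.inner_apply, Matrix.toLpLin_apply, Matrix.mulVec, dotProduct, Finset.mul_sum,
    mul_comm]

lemma norm_toEuclideanLin_sq_le (A : Matrix (Fin d) (Fin d) ℝ) {n : Euc d} (hn : ‖n‖ = 1) :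
    inner ℝ (Matrix.toEuclideanLin A n) (Matrix.toEuclideanLin A n) ≤ frob A A := by
  have h1 : ∑ j, n j ^ 2 = 1 := by
    rw [← EuclideanSpace.real_norm_sq_eq, hn, one_pow]
  rw [PiLp.inner_apply]
  refine Finset.sum_le_sum fun i _ => ?_
  have h2 := Finset.sum_mul_sq_le_sq_mul_sq Finset.univ (fun j => A i j) (fun j => n j)
  rw [h1, mul_one] at h2
  simp only [Matrix.toLpLin_apply, Matrix.mulVec, dotProduct, ← sq] at h2 ⊢
  simpa [sq] using h2

lemma ipElem_self_nonneg (T : Set (Euc d)) (A : Euc d → Matrix (Fin d) (Fin d) ℝ) :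
    0 ≤ ipElem T A A := integral_nonneg fun _ => frob_self_nonneg _

lemma ipElem_comm (T : Set (Euc d)) (A B : Euc d → Matrix (Fin d) (Fin d) ℝ) :
    ipElem T A B = ipElem T B A := by
  simp only [ipElem, frob_comm]

lemma ipElem_self_le {T : Set (Euc d)} (hT : IsCompact T)
    {A B : Euc d → Matrix (Fin d) (Fin d) ℝ} (hA : ContMat A) (hB : ContMat B) :
    ipElem T A A ≤ 2 * ipElem T B B +
      2 * ipElem T (fun x => A x - B x) (fun x => A x - B x) := by
  have h1 := hA.integrableOn_frob hA hT
  have h2 := (hB.integrableOn_frob hB hT).const_mul 2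
  have h3 := ((hA.sub hB).integrableOn_frob (hA.sub hB) hT).const_mul 2
  simp only [ipElem]
  rw [← integral_const_mul, ← integral_const_mul, ← integral_add h2 h3]
  exact integral_mono h1 (h2.add h3) fun x => frob_self_le _ _

end WG

namespace WG

/-! ### The projection onto the side space -/

variable {d : ℕ}

/-- The vector field with polynomial part `w.1` and rigid motion with translation `w.2.1` and
rotation the skew part of `w.2.2`. -/
def sideField (r : ℕ) :
    ((Fin d → polySub d r) × Euc d × Matrix (Fin d) (Fin d) ℝ) →ₗ[ℝ] (Euc d → Euc d) where
  toFun w x := WithLp.toLp 2 (fun i => (w.1 i).1 x) +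
    (w.2.1 + Matrix.toEuclideanLin (w.2.2 - w.2.2ᵀ) x)
  map_add' w z := by
    ext x i
    simp [Matrix.toLpLin_apply]
    ring
  map_smul' a w := by
    ext x i
    simp [Matrix.toLpLin_apply]
    ring

lemma continuous_toEuclideanLin (A : Matrix (Fin d) (Fin d) ℝ) :
    Continuous fun x : Euc d => Matrix.toEuclideanLin A x :=
  LinearMap.continuous_of_finiteDimensional _

lemma continuous_sideField (r : ℕ) (w : (Fin d → polySub d r) × Euc d × Matrix (Fin d) (Fin d) ℝ) :
    Continuous (sideField r w) := by
  have h1 : Continuous fun x : Euc d => (WithLp.toLp 2 (fun i => (w.1 i).1 x) : Euc d) :=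
    (PiLp.continuous_toLp 2 _).comp (continuous_pi fun i => IsPoly.continuous (w.1 i).2)
  exact h1.add (continuous_const.add (continuous_toEuclideanLin _))

lemma inSideSpace_sideField (r : ℕ) (e : Set (Euc d))
    (w : (Fin d → polySub d r) × Euc d × Matrix (Fin d) (Fin d) ℝ) :
    InSideSpace r e (sideField r w) :=
  ⟨fun x => WithLp.toLp 2 (fun i => (w.1 i).1 x),
    fun x => w.2.1 + Matrix.toEuclideanLin (w.2.2 - w.2.2ᵀ) x, fun i => (w.1 i).2,
    ⟨w.2.1, w.2.2 - w.2.2ᵀ, by simp, fun _ => rfl⟩, fun _ _ => rfl⟩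

lemma InSideSpace.exists_sideField {r : ℕ} {e : Set (Euc d)} {z : Euc d → Euc d}
    (hz : InSideSpace r e z) : ∃ w, ∀ x ∈ e, z x = sideField r w x := by
  obtain ⟨p, q, hp, ⟨a, η, hη, hq⟩, hz⟩ := hz
  refine ⟨(fun i => ⟨fun x => p x i, hp i⟩, a, (1 / 2 : ℝ) • η), fun x hx => ?_⟩
  -- `sideField` uses `A - Aᵀ` without the factor `1 / 2`, so a skew `η` has the parameter `η / 2`.
  have h1 : (1 / 2 : ℝ) • η - ((1 / 2 : ℝ) • η)ᵀ = η := by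
    rw [Matrix.transpose_smul, hη, smul_neg, sub_neg_eq_add, ← add_smul]
    norm_num
  rw [hz x hx, hq]
  change _ = _ + (_ + Matrix.toEuclideanLin _ x)
  simp only [h1]

lemma InSideSpace.continuousOn {r : ℕ} {e : Set (Euc d)} {z : Euc d → Euc d}
    (hz : InSideSpace r e z) : ContinuousOn z e := by
  obtain ⟨w, hw⟩ := hz.exists_sideField
  exact (continuous_sideField r w).continuousOn.congr hw

/-- The normal equations of the projection, solved on the parameter space of `sideField`. The
parametrization need not be injective, since constants are also rigid motions, so the form is only
semidefinite there. -/
lemma exists_isSideProj (r : ℕ) {e : Set (Euc d)} (he : IsFlat e) {f : Euc d → Euc d}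
    (hf : ContinuousOn f e) : ∃ w, IsSideProj r e f w := by
  have hc := fun w => (continuous_sideField (d := d) r w).continuousOn (s := e)
  let lin : (g : Euc d → Euc d) → ContinuousOn g e →
      ((Fin d → polySub d r) × Euc d × Matrix (Fin d) (Fin d) ℝ) →ₗ[ℝ] ℝ := fun g hg =>
    { toFun := fun w => ipSide e g (sideField r w)
      map_add' := fun w z => by
        rw [map_add]
        exact ipSide_add_right he hg (hc w) (hc z)
      map_smul' := fun a w => by
        rw [map_smul]
        exact ipSide_smul_right e g _ a }
  let B : ((Fin d → polySub d r) × Euc d × Matrix (Fin d) (Fin d) ℝ) →ₗ[ℝ]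
      ((Fin d → polySub d r) × Euc d × Matrix (Fin d) (Fin d) ℝ) →ₗ[ℝ] ℝ :=
    { toFun := fun w => lin (sideField r w) (hc w)
      map_add' := fun w z => by
        refine LinearMap.ext fun u => ?_
        change ipSide e (sideField r (w + z)) _ = ipSide e (sideField r w) _ + ipSide e _ _
        rw [ipSide_comm, ipSide_comm e (sideField r w), ipSide_comm e (sideField r z), map_add]
        exact ipSide_add_right he (hc u) (hc w) (hc z)
      map_smul' := fun a w => by
        refine LinearMap.ext fun u => ?_
        change ipSide e (sideField r (a • w)) _ = a * ipSide e (sideField r w) _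
        rw [ipSide_comm, ipSide_comm e (sideField r w), map_smul]
        exact ipSide_smul_right e _ _ a }
  obtain ⟨w, hw⟩ := exists_representer B (fun x y => ipSide_comm e _ _) (lin f hf)
    fun w h => ipSide_eq_zero_of_self he f (hc w) h
  refine ⟨sideField r w, inSideSpace_sideField r e w, fun z hz => ?_⟩
  obtain ⟨u, hu⟩ := hz.exists_sideField
  have h1 : ipSide e (sideField r w) (sideField r u) = ipSide e f (sideField r u) := hw u
  rw [ipSide_congr he (fun _ _ => rfl) hu, ipSide_sub_left he hf (hc w) (hc u), h1, sub_self]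

lemma isSideProj_sideProj (r : ℕ) {e : Set (Euc d)} (he : IsFlat e) {f : Euc d → Euc d}
    (hf : ContinuousOn f e) : IsSideProj r e f (sideProj r e f) :=
  Classical.epsilon_spec (exists_isSideProj r he hf)

/-! ### The weak gradient -/

/-- The gradient of a vector field. -/
def grad (u : Euc d → Euc d) (x : Euc d) : Matrix (Fin d) (Fin d) ℝ :=
  Matrix.of fun i j => pd j (fun y => u y i) x

lemma IsPolyVec.grad {r : ℕ} {u : Euc d → Euc d} (hu : IsPolyVec r u) :
    IsPolyMat (r - 1) (WG.grad u) := fun i j => (hu i).pd j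

lemma IsPolyVec.continuous {r : ℕ} {u : Euc d → Euc d} (hu : IsPolyVec r u) : Continuous u :=
  (PiLp.continuous_toLp 2 _).comp (continuous_pi fun i => (hu i).continuous)

/-- The normal of a flat side is constant, so `φ n` keeps the degree of `φ`. With
`IsPolyVec.inSideSpace` it becomes an admissible test function for `Q_b`. -/
lemma isPolyVec_apply {r : ℕ} {φ : Euc d → Matrix (Fin d) (Fin d) ℝ} (hφ : IsPolyMat r φ)
    (n : Euc d) : IsPolyVec r fun x => Matrix.toEuclideanLin (φ x) n := by
  intro i
  have h : ∀ s : Finset (Fin d), IsPoly r fun x => ∑ j ∈ s, n j * φ x i j := fun s => by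
    induction s using Finset.cons_induction with
    | empty => simpa using isPoly_const r 0
    | cons j s hj ih =>
      simp only [Finset.sum_cons]
      exact ((hφ i j).const_mul _).add ih
  simpa [Matrix.toLpLin_apply, Matrix.mulVec, dotProduct, mul_comm] using h Finset.univ

lemma IsPolyVec.inSideSpace {r : ℕ} {u : Euc d → Euc d} (hu : IsPolyVec r u) (e : Set (Euc d)) :
    InSideSpace r e u :=
  ⟨u, fun _ => 0, hu, ⟨0, 0, by simp, by simp⟩, by simp⟩

variable {T : Set (Euc d)} {S : Finset (Set (Euc d))} {N : Set (Euc d) → Euc d}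

lemma FlatSided.isFlat (h : FlatSided T S N) {e : Set (Euc d)} (he : e ∈ S) : IsFlat e := by
  obtain ⟨p, -, hp⟩ := h.hyperplane he
  exact ⟨(h.polytope e he).compact, N e, p, (h.normal e he).1, hp⟩

/-- Integration by parts. -/
lemma FlatSided.integral_inner_divMat (h : FlatSided T S N) (hd : 1 ≤ d) {k r : ℕ}
    {u : Euc d → Euc d} (hu : IsPolyVec k u) {φ : Euc d → Matrix (Fin d) (Fin d) ℝ}
    (hφ : IsPolyMat r φ) :
    ipElem T (grad u) φ + ∫ x in T, inner ℝ (u x) (divMat φ x) =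
      ∑ e ∈ S, ipSide e u fun x => Matrix.toEuclideanLin (φ x) (N e) := by
  have hcd : ∀ i j, ContDiff ℝ 1 fun x => u x i * φ x i j := fun i j =>
    (hu i).contDiff.mul (hφ i j).contDiff
  have hleib : ∀ i j x, pd j (fun y => u y i) x * φ x i j + u x i * pd j (fun y => φ y i j) x =
      fderiv ℝ (fun x => u x i * φ x i j) x (EuclideanSpace.single j 1) := fun i j x => by
    rw [fderiv_fun_mul ((hu i).differentiable x) ((hφ i j).differentiable x)]
    simp only [pd, add_apply, smul_apply, smul_eq_mul]
    ring
  have hi1 : IntegrableOn (fun x => frob (grad u x) (φ x)) T :=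
    hu.grad.contMat.integrableOn_frob hφ.contMat h.compact
  have hdiv : Continuous fun x => divMat φ x :=
    (PiLp.continuous_toLp 2 _).comp (continuous_pi fun i =>
      continuous_finsetSum _ fun j _ => ((hφ i j).pd j).continuous)
  have hi2 : IntegrableOn (fun x => inner ℝ (u x) (divMat φ x)) T :=
    (hu.continuous.inner hdiv).continuousOn.integrableOn_compact h.compact
  have hi3 : ∀ i j, IntegrableOn
      (fun x => fderiv ℝ (fun x => u x i * φ x i j) x (EuclideanSpace.single j 1)) T :=
    fun i j => (((hcd i j).continuous_fderiv one_ne_zero).clm_apply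
      continuous_const).continuousOn.integrableOn_compact h.compact
  have hsum : ∀ x, frob (grad u x) (φ x) + inner ℝ (u x) (divMat φ x) =
      ∑ i, ∑ j, fderiv ℝ (fun x => u x i * φ x i j) x (EuclideanSpace.single j 1) := fun x => by
    simp only [frob, grad, divMat, PiLp.inner_apply, RCLike.inner_apply, conj_trivial,
      Matrix.of_apply, Finset.sum_mul, ← Finset.sum_add_distrib, ← hleib, mul_comm (u x _)]
  rw [ipElem, ← integral_add hi1 hi2, integral_congr_ae (Filter.Eventually.of_forall hsum),
    integral_finsetSum _ fun i _ => integrable_finsetSum _ fun j _ => hi3 i j]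
  -- The scalar divergence theorem for `u_i φ_ij` in the coordinate direction `j`, where `N e · v`
  -- is the component `N e j`.
  have hint : ∀ i, ∫ x in T, ∑ j,
      fderiv ℝ (fun x => u x i * φ x i j) x (EuclideanSpace.single j 1) =
      ∑ j, ∑ e ∈ S, N e j * ∫ x in e, u x i * φ x i j ∂(surf d) := fun i => by
    rw [integral_finsetSum _ fun j _ => hi3 i j]
    refine Finset.sum_congr rfl fun j _ => ?_
    rw [h.integral_fderiv hd _ (hcd i j)]
    simp [EuclideanSpace.inner_single_right]
  simp only [hint]
  rw [Finset.sum_congr rfl fun i _ => Finset.sum_comm, Finset.sum_comm]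
  refine Finset.sum_congr rfl fun e he => ?_
  have hie : ∀ i j, IntegrableOn (fun x => u x i * (φ x i j * N e j)) e (surf d) := fun i j =>
    (h.isFlat he).integrableOn
      ((hu i).continuous.mul ((hφ i j).continuous.mul continuous_const)).continuousOn
  simp only [ipSide, inner_toEuclideanLin]
  rw [integral_finsetSum _ fun i _ => integrable_finsetSum _ fun j _ => hie i j]
  refine Finset.sum_congr rfl fun i _ => ?_
  rw [integral_finsetSum _ fun j _ => hie i j]
  refine Finset.sum_congr rfl fun j _ => ?_
  rw [← integral_const_mul]
  congr 1
  ext x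
  ring

/-- The trace inequality for matrix fields on the sides of `T`. -/
def HasTrace (T : Set (Euc d)) (S : Finset (Set (Euc d))) (r : ℕ) (C : ℝ) : Prop :=
  ∀ e ∈ S, ∀ f : Euc d → ℝ, IsPoly r f → ∫ x in e, f x ^ 2 ∂(surf d) ≤ C * ∫ x in T, f x ^ 2

lemma FlatSided.ipSide_apply_le (h : FlatSided T S N) {r : ℕ} {C : ℝ} (hC : HasTrace T S r C)
    {φ : Euc d → Matrix (Fin d) (Fin d) ℝ} (hφ : IsPolyMat r φ) {e : Set (Euc d)} (he : e ∈ S) :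
    ipSide e (fun x => Matrix.toEuclideanLin (φ x) (N e))
      (fun x => Matrix.toEuclideanLin (φ x) (N e)) ≤ C * ipElem T φ φ := by
  have hc := (hφ.contMat.continuous_apply (N e)).continuousOn (s := e)
  have hie : ∀ i j, IntegrableOn (fun x => φ x i j * φ x i j) e (surf d) := fun i j =>
    (h.isFlat he).integrableOn ((hφ i j).continuous.mul (hφ i j).continuous).continuousOn
  have hiT : ∀ i j, IntegrableOn (fun x => φ x i j * φ x i j) T := fun i j =>
    ((hφ i j).continuous.mul (hφ i j).continuous).continuousOn.integrableOn_compact h.compact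
  calc _ ≤ ∫ x in e, frob (φ x) (φ x) ∂(surf d) :=
        integral_mono ((h.isFlat he).integrableOn_inner hc hc)
          ((h.isFlat he).integrableOn (hφ.contMat.frob hφ.contMat).continuousOn)
          fun x => norm_toEuclideanLin_sq_le _ (h.normal e he).1
    _ = ∑ i, ∑ j, ∫ x in e, φ x i j * φ x i j ∂(surf d) := by
        simp only [frob]
        rw [integral_finsetSum _ fun i _ => integrable_finsetSum _ fun j _ => hie i j]
        exact Finset.sum_congr rfl fun i _ => integral_finsetSum _ fun j _ => hie i j
    _ ≤ ∑ i, ∑ j, C * ∫ x in T, φ x i j * φ x i j := by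
        refine Finset.sum_le_sum fun i _ => Finset.sum_le_sum fun j _ => ?_
        simpa only [sq] using hC e he _ (hφ i j)
    _ = C * ipElem T φ φ := by
        simp only [ipElem, frob, ← Finset.mul_sum]
        rw [integral_finsetSum _ fun i _ => integrable_finsetSum _ fun j _ => hiT i j]
        exact congrArg _ (Finset.sum_congr rfl fun i _ =>
          (integral_finsetSum _ fun j _ => hiT i j).symm)

end WG

/-! ### Existence of the weak gradient and comparison of the strains -/

namespace WG

variable {d : ℕ} {T : Set (Euc d)} {S : Finset (Set (Euc d))} {N : Set (Euc d) → Euc d}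

/-- The matrix field with polynomial entries `w i j`. -/
def matField (r : ℕ) : (Fin d → Fin d → polySub d r) →ₗ[ℝ] (Euc d → Matrix (Fin d) (Fin d) ℝ) where
  toFun w x := Matrix.of fun i j => (w i j).1 x
  map_add' _ _ := rfl
  map_smul' _ _ := rfl

lemma isPolyMat_matField (r : ℕ) (w : Fin d → Fin d → polySub d r) :
    IsPolyMat r (matField r w) := fun i j => (w i j).2

lemma ipElem_add_right (hT : IsCompact T) {A B C : Euc d → Matrix (Fin d) (Fin d) ℝ}
    (hA : ContMat A) (hB : ContMat B) (hC : ContMat C) :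
    ipElem T A (B + C) = ipElem T A B + ipElem T A C := by
  simp only [ipElem, Pi.add_apply, frob_add_right]
  exact integral_add (hA.integrableOn_frob hB hT) (hA.integrableOn_frob hC hT)

lemma ipElem_smul_right (A B : Euc d → Matrix (Fin d) (Fin d) ℝ) (a : ℝ) :
    ipElem T A (a • B) = a * ipElem T A B := by
  simp only [ipElem, Pi.smul_apply, frob_smul_right, integral_const_mul]

lemma ipElem_sub_left (hT : IsCompact T) {A B C : Euc d → Matrix (Fin d) (Fin d) ℝ}
    (hA : ContMat A) (hB : ContMat B) (hC : ContMat C) :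
    ipElem T (fun x => A x - B x) C = ipElem T A C - ipElem T B C := by
  simp only [ipElem, frob_sub_left]
  exact integral_sub (hA.integrableOn_frob hC hT) (hB.integrableOn_frob hC hT)

lemma ipElem_eq_zero_of_self (hT : IsCompact T) (A : Euc d → Matrix (Fin d) (Fin d) ℝ)
    {B : Euc d → Matrix (Fin d) (Fin d) ℝ} (hB : ContMat B) (h : ipElem T B B = 0) :
    ipElem T A B = 0 := by
  have h1 := (setIntegral_eq_zero_iff_of_nonneg_ae
    (Filter.Eventually.of_forall fun x => frob_self_nonneg (B x))
    (hB.integrableOn_frob hB hT)).1 h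
  refine integral_eq_zero_of_ae ?_
  filter_upwards [h1] with x hx
  have h2 : ∀ i j, B x i j = 0 := fun i j => by
    have h3 := (Finset.sum_eq_zero_iff_of_nonneg fun i _ =>
      Finset.sum_nonneg fun j _ => mul_self_nonneg (B x i j)).1 hx i (Finset.mem_univ i)
    exact mul_self_eq_zero.1 ((Finset.sum_eq_zero_iff_of_nonneg fun j _ =>
      mul_self_nonneg (B x i j)).1 h3 j (Finset.mem_univ j))
  simp [frob, h2]

/-- The functional `φ ↦ (∇u, φ)_T - ∑ₑ ⟨u - b, φ n⟩_e` is represented by a polynomial field. -/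
lemma FlatSided.exists_gradient (h : FlatSided T S N) {k r : ℕ} {C : ℝ} (hC : HasTrace T S r C)
    {u : Euc d → Euc d} (hu : IsPolyVec k u) {b : Set (Euc d) → Euc d → Euc d}
    (hb : ∀ e ∈ S, ContinuousOn (b e) e) :
    ∃ G, IsPolyMat r G ∧ ∀ φ, IsPolyMat r φ → ipElem T G φ = ipElem T (grad u) φ -
      ∑ e ∈ S, ipSide e (fun x => u x - b e x) fun x => Matrix.toEuclideanLin (φ x) (N e) := by
  have hM : ∀ w : Fin d → Fin d → polySub d r, ContMat (matField r w) :=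
    fun w => (isPolyMat_matField r w).contMat
  have hub : ∀ e ∈ S, ContinuousOn (fun x => u x - b e x) e := fun e he =>
    hu.continuous.continuousOn.sub (hb e he)
  have hMn : ∀ (w : Fin d → Fin d → polySub d r) (e : Set (Euc d)),
      ContinuousOn (fun x => Matrix.toEuclideanLin (matField r w x) (N e)) e := fun w e =>
    ((hM w).continuous_apply (N e)).continuousOn
  let B : (Fin d → Fin d → polySub d r) →ₗ[ℝ] (Fin d → Fin d → polySub d r) →ₗ[ℝ] ℝ :=
    LinearMap.mk₂ ℝ (fun w z => ipElem T (matField r w) (matField r z))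
      (fun w w' z => by
        rw [ipElem_comm, map_add, ipElem_add_right h.compact (hM z) (hM w) (hM w'),
          ipElem_comm, ipElem_comm T _ (matField r w')])
      (fun a w z => by rw [ipElem_comm, map_smul, ipElem_smul_right, ipElem_comm, smul_eq_mul])
      (fun w z z' => by rw [map_add, ipElem_add_right h.compact (hM w) (hM z) (hM z')])
      (fun a w z => by rw [map_smul, ipElem_smul_right, smul_eq_mul])
  let L : (Fin d → Fin d → polySub d r) →ₗ[ℝ] ℝ :=
    { toFun := fun w => ipElem T (grad u) (matField r w) - ∑ e ∈ S,
        ipSide e (fun x => u x - b e x) fun x => Matrix.toEuclideanLin (matField r w x) (N e)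
      map_add' := fun w z => by
        rw [map_add, ipElem_add_right h.compact hu.grad.contMat (hM w) (hM z)]
        simp only [Pi.add_apply, map_add, LinearMap.add_apply]
        rw [Finset.sum_congr rfl fun e he => ipSide_add_right (h.isFlat he) (hub e he)
          (hMn w e) (hMn z e), Finset.sum_add_distrib]
        ring
      map_smul' := fun a w => by
        rw [map_smul, ipElem_smul_right]
        simp only [Pi.smul_apply, map_smul, LinearMap.smul_apply, ipSide_smul_right,
          ← Finset.mul_sum, RingHom.id_apply, smul_eq_mul]
        ring }
  obtain ⟨G, hG⟩ := exists_representer B (fun x y => ipElem_comm T _ _) L fun w hw => by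
    have hw' : ipElem T (matField r w) (matField r w) = 0 := hw
    change ipElem T (grad u) (matField r w) - _ = 0
    rw [ipElem_eq_zero_of_self h.compact _ (hM w) hw', zero_sub, neg_eq_zero]
    refine Finset.sum_eq_zero fun e he => ?_
    -- A field of zero norm on `T` has zero normal trace on every side by the trace inequality, so
    -- the boundary terms respect the isotropic vectors.
    refine ipSide_eq_zero_of_self (h.isFlat he) _ (hMn w e) (le_antisymm ?_ (ipSide_self_nonneg _ _))
    have h1 := h.ipSide_apply_le hC (isPolyMat_matField r w) he
    rwa [hw', mul_zero] at h1
  exact ⟨matField r G, isPolyMat_matField r G, fun φ hφ => hG fun i j => ⟨fun x => φ x i j, hφ i j⟩⟩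

lemma IsPolyMat.symm {r : ℕ} {A : Euc d → Matrix (Fin d) (Fin d) ℝ} (hA : IsPolyMat r A) :
    IsPolyMat r fun x => (1 / 2 : ℝ) • (A x + (A x)ᵀ) := fun i j =>
  ((hA i j).add (hA j i)).const_mul _

lemma strain_eq (u : Euc d → Euc d) (x : Euc d) :
    strain u x = (1 / 2 : ℝ) • (grad u x + (grad u x)ᵀ) := by
  ext i j
  simp only [strain, grad, Matrix.of_apply, Matrix.smul_apply, Matrix.add_apply,
    Matrix.transpose_apply, smul_eq_mul]
  ring

/-- The difference between weak and classical strain is controlled by the jumps. -/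
lemma FlatSided.strain_sub_le (h : FlatSided T S N) {k r n : ℕ} {C : ℝ} (hC0 : 0 < C)
    (hC : HasTrace T S r C) (hr : k - 1 ≤ r) (hn : S.card ≤ n) {u : Euc d → Euc d}
    (hu : IsPolyVec k u) {b q : Set (Euc d) → Euc d → Euc d}
    (hb : ∀ e ∈ S, InSideSpace r e (b e)) (hq : ∀ e ∈ S, IsSideProj r e u (q e))
    {G : Euc d → Matrix (Fin d) (Fin d) ℝ} (hG : IsPolyMat r G)
    (hGφ : ∀ φ, IsPolyMat r φ → ipElem T G φ = ipElem T (grad u) φ -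
      ∑ e ∈ S, ipSide e (fun x => u x - b e x) fun x => Matrix.toEuclideanLin (φ x) (N e)) :
    ipElem T (fun x => (1 / 2 : ℝ) • (G x + (G x)ᵀ) - strain u x)
      (fun x => (1 / 2 : ℝ) • (G x + (G x)ᵀ) - strain u x) ≤
      (n + 1) * C * ∑ e ∈ S, ipSide e (fun x => q e x - b e x) (fun x => q e x - b e x) := by
  have hgr : IsPolyMat r (grad u) := fun i j => (hu.grad i j).mono hr
  set φ : Euc d → Matrix (Fin d) (Fin d) ℝ :=
    fun x => (1 / 2 : ℝ) • (G x + (G x)ᵀ) - strain u x with hφdef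
  have hφ : IsPolyMat r φ := by
    simp only [hφdef, strain_eq]
    exact fun i j => (hG.symm i j).sub (hgr.symm i j)
  have hsymm : ∀ x, (φ x)ᵀ = φ x := fun x => by
    simp only [hφdef, strain_eq, Matrix.transpose_sub, Matrix.transpose_smul, Matrix.transpose_add,
      Matrix.transpose_transpose, add_comm]
  -- Tested against the symmetric `φ`, the symmetric parts of `G` and `grad u` may be replaced by
  -- the full matrices; so `φ` can be used in `hGφ`.
  have h1 : ipElem T φ φ = ipElem T (fun x => G x - grad u x) φ := by
    simp only [ipElem]
    refine integral_congr_ae (Filter.Eventually.of_forall fun x => ?_)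
    simp only
    conv_lhs => arg 1; rw [hφdef]
    simp only [frob_sub_left, strain_eq, frob_symm_part _ (hsymm x)]
  have hcφ : ∀ e, ContinuousOn (fun x => Matrix.toEuclideanLin (φ x) (N e)) e := fun e =>
    (hφ.contMat.continuous_apply (N e)).continuousOn
  have hcJ : ∀ e ∈ S, ContinuousOn (fun x => q e x - b e x) e := fun e he =>
    (hq e he).1.continuousOn.sub (hb e he).continuousOn
  -- Here `u` is exchanged for its projection: `u - q e` is orthogonal to `φ n`, which belongs to
  -- the side space.
  have h2 : ipElem T φ φ = ∑ e ∈ S, -ipSide e (fun x => q e x - b e x)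
      fun x => Matrix.toEuclideanLin (φ x) (N e) := by
    rw [h1, ipElem_sub_left h.compact hG.contMat hgr.contMat hφ.contMat, hGφ φ hφ,
      sub_sub_cancel_left, ← Finset.sum_neg_distrib]
    refine Finset.sum_congr rfl fun e he => ?_
    have hcu := hu.continuous.continuousOn (s := e)
    have h3 := (hq e he).2 _ ((isPolyVec_apply hφ (N e)).inSideSpace e)
    rw [ipSide_sub_left (h.isFlat he) hcu (hq e he).1.continuousOn (hcφ e)] at h3
    rw [ipSide_sub_left (h.isFlat he) hcu (hb e he).continuousOn (hcφ e),
      ipSide_sub_left (h.isFlat he) (hq e he).1.continuousOn (hb e he).continuousOn (hcφ e)]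
    linarith
  set J := ∑ e ∈ S, ipSide e (fun x => q e x - b e x) (fun x => q e x - b e x) with hJ
  -- This Young parameter makes the trace terms of at most `n` sides add up to at most half of
  -- `‖φ‖²`, leaving `‖φ‖² ≤ a J`; `n + 1` keeps it positive when `n = 0`.
  set a : ℝ := (n + 1) * C with ha
  have ha0 : 0 < a := by positivity
  have hX0 := ipElem_self_nonneg T φ
  have h4 : ipElem T φ φ ≤ a / 2 * J + S.card * (1 / (2 * a) * (C * ipElem T φ φ)) := by
    conv_lhs => rw [h2]
    rw [hJ, Finset.mul_sum, ← nsmul_eq_mul, ← Finset.sum_const, ← Finset.sum_add_distrib]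
    refine Finset.sum_le_sum fun e he => ?_
    refine (neg_ipSide_le (h.isFlat he) (hcJ e he) (hcφ e) ha0).trans ?_
    gcongr
    exact h.ipSide_apply_le hC hφ he
  have h5 : S.card * (1 / (2 * a) * (C * ipElem T φ φ)) ≤ 1 / 2 * ipElem T φ φ := by
    have h6 : (S.card : ℝ) * (1 / (2 * a) * (C * ipElem T φ φ)) =
        (S.card / (n + 1)) * (1 / 2 * ipElem T φ φ) := by
      rw [ha]; field_simp
    rw [h6]
    refine mul_le_of_le_one_left (by positivity) ((div_le_one (by positivity)).2 ?_)
    have : (S.card : ℝ) ≤ n := by exact_mod_cast hn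
    linarith
  linarith

/-! ### The elements of a shape regular partition -/

lemma Mesh.mem_sides {M : Mesh d} {e : Set (Euc d)} (he : e ∈ M.sidesOf T) : e ∈ M.sides := by
  classical
  exact (Finset.mem_filter.1 he).1

lemma Mesh.IsPartition.flatSided {M : Mesh d} {Ω : Set (Euc d)} (hM : M.IsPartition Ω)
    (hT : T ∈ M.elements) : FlatSided T (M.sidesOf T) (outwardNormal T) := by
  exact ⟨(hM.elements_polytope T hT).compact, hM.frontier_eq T hT,
    fun e he => hM.sides_polytope e (Mesh.mem_sides he),
    fun e he e' he' => hM.sides_disjoint e (Mesh.mem_sides he) e' (Mesh.mem_sides he'),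
    fun e he => Classical.epsilon_spec (hM.exists_normal T hT e he)⟩

lemma IsPolytope.size_pos (hd : 1 ≤ d) (hT : IsPolytope d T) : 0 < size T := by
  refine lt_of_le_of_ne Metric.diam_nonneg fun h0 => ?_
  have h1 : T.Subsingleton := fun x hx y hy => by
    have := Metric.dist_le_diam_of_mem hT.compact.isBounded hx hy
    exact dist_le_zero.1 (this.trans h0.symm.le)
  have h2 := hT.dim
  rw [direction_affineSpan, vectorSpan_of_subsingleton ℝ h1, finrank_bot] at h2
  omega

/-- Shape regularity enters here: the pyramid over a side has height at least `c.sigma * size T`, so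
the trace constant scales like `h_T⁻¹`. -/
lemma exists_hasTrace (d r : ℕ) (hd : 1 ≤ d) (c : ShapeConstants) : ∃ C : ℝ, 0 < C ∧
    ∀ (Ω : Set (Euc d)) (M : Mesh d), M.IsPartition Ω → M.ShapeRegular c → ∀ T ∈ M.elements,
      HasTrace T (M.sidesOf T) r (C * (size T)⁻¹) := by
  obtain ⟨C, hC, h⟩ := exists_trace_inequality d r
  have hs := c.sigma_pos
  refine ⟨C / c.sigma, div_pos hC hs, fun Ω M hM hreg T hT e he f hf => ?_⟩
  have hfl := hM.flatSided hT
  have hsize := (hM.elements_polytope T hT).size_pos hd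
  obtain ⟨A, hA, σ, hσ, hsub, hbase⟩ := hreg.pyramid T hT e he
  have hσ0 : 0 < σ := hs.trans_le hσ
  have h1 := h T e (outwardNormal T e) A (σ * size T) (hfl.normal e he).1 (mul_pos hσ0 hsize)
    hfl.compact (hfl.isFlat he).compact (fun x hx => (hbase x hx).1) (fun y hy t ht => hsub <| by
      rw [mem_convexJoin]
      refine ⟨A, rfl, y, hy, ?_⟩
      rw [segment_eq_image']
      exact ⟨t, ⟨ht.1.le, ht.2.le⟩, rfl⟩) f hf
  have h0 : 0 ≤ ∫ x in e, f x ^ 2 ∂(surf d) := integral_nonneg fun x => sq_nonneg _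
  have h2 : c.sigma * size T * ∫ x in e, f x ^ 2 ∂(surf d) ≤ C * ∫ x in T, f x ^ 2 :=
    le_trans (by gcongr) h1
  have h3 : ∫ x in e, f x ^ 2 ∂(surf d) ≤ (C * ∫ x in T, f x ^ 2) / (c.sigma * size T) := by
    rw [le_div_iff₀ (mul_pos hs hsize), mul_comm]
    exact h2
  refine h3.trans (le_of_eq ?_)
  field_simp

/-- The factor `h_T⁻¹` of the trace inequality is exactly the weight of the stabilizer, so `K` does
not depend on the mesh size. -/
lemma exists_strain_sub_le (d k : ℕ) (hd : 1 ≤ d) (c : ShapeConstants) (N : ℕ) :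
    ∃ K : ℝ, 0 < K ∧ ∀ (Ω : Set (Euc d)) (M : Mesh d), M.IsPartition Ω → M.ShapeRegular c →
      ∀ T ∈ M.elements, (M.sidesOf T).card ≤ N → ∀ v : WeakFun d, InV k M v →
        ContMat (weakStrain (k - 1) M v T) ∧
        ipElem T (fun x => weakStrain (k - 1) M v T x - strain (v.inn T) x)
          (fun x => weakStrain (k - 1) M v T x - strain (v.inn T) x) ≤
          K * ((size T)⁻¹ * ∑ e ∈ M.sidesOf T, ipSide e (jump k v T e) (jump k v T e)) := by
  obtain ⟨C, hC, htr⟩ := exists_hasTrace d (k - 1) hd c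
  refine ⟨(N + 1) * C, by positivity, fun Ω M hM hreg T hT hN v hv => ?_⟩
  have hfl := hM.flatSided hT
  have htrT := htr Ω M hM hreg T hT
  have hsize := (hM.elements_polytope T hT).size_pos hd
  have hu := hv.1 T hT
  have hb : ∀ e ∈ M.sidesOf T, InSideSpace (k - 1) e (v.bdy e) := fun e he =>
    hv.2 e (Mesh.mem_sides he)
  have hbc : ∀ e ∈ M.sidesOf T, ContinuousOn (v.bdy e) e := fun e he => (hb e he).continuousOn
  have hibp : ∀ φ, IsPolyMat (k - 1) φ → -(∫ x in T, inner ℝ (v.inn T x) (divMat φ x)) +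
      ∑ e ∈ M.sidesOf T,
        ipSide e (v.bdy e) (fun x => Matrix.toEuclideanLin (φ x) (outwardNormal T e)) =
      ipElem T (grad (v.inn T)) φ - ∑ e ∈ M.sidesOf T, ipSide e (fun x => v.inn T x - v.bdy e x)
        fun x => Matrix.toEuclideanLin (φ x) (outwardNormal T e) := fun φ hφ => by
    have h1 := hfl.integral_inner_divMat hd hu hφ
    rw [Finset.sum_congr rfl fun e he => ipSide_sub_left (hfl.isFlat he)
      hu.continuous.continuousOn (hbc e he)
      (hφ.contMat.continuous_apply (outwardNormal T e)).continuousOn,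
      Finset.sum_sub_distrib, ← h1]
    ring
  -- The chosen `weakGrad` satisfies its defining identity because some field does, namely the
  -- representer.
  have hG : IsWeakGrad (k - 1) M T v (weakGrad (k - 1) M v T) := by
    obtain ⟨G, hG, hGφ⟩ := hfl.exists_gradient htrT hu hbc
    exact Classical.epsilon_spec (p := IsWeakGrad (k - 1) M T v)
      ⟨G, hG, fun φ hφ => by rw [hGφ φ hφ, hibp φ hφ]⟩
  refine ⟨hG.1.symm.contMat, ?_⟩
  have h2 := hfl.strain_sub_le (n := N) (mul_pos hC (inv_pos.2 hsize)) htrT le_rfl hN hu hb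
    (q := fun e => sideProj (k - 1) e (v.inn T))
    (fun e he => isSideProj_sideProj (k - 1) (hfl.isFlat he) hu.continuous.continuousOn)
    hG.1 (fun φ hφ => by rw [hG.2 φ hφ, hibp φ hφ])
  refine h2.trans (le_of_eq ?_)
  have hj : ∀ e, jump k v T e = fun x => sideProj (k - 1) e (v.inn T) x - v.bdy e x := fun _ => rfl
  simp only [hj]
  ring

end WG

end

/-! ### The norm equivalence -/

theorem mainTheorem6 (d : ℕ) (hd : d = 2 ∨ d = 3) (k : ℕ) (hk : 1 ≤ k) (μ : ℝ) (hμ : 0 < μ)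
    (c : WG.ShapeConstants) (N : ℕ) :
    ∃ α₁ α₂ : ℝ, 0 < α₁ ∧ 0 < α₂ ∧
      ∀ (Ω : Set (WG.Euc d)), IsOpen Ω → Bornology.IsBounded Ω → IsConnected Ω →
        WG.HasLipschitzBoundary Ω →
      ∀ (M : WG.Mesh d), M.IsPartition Ω → M.ShapeRegular c →
        (∀ T ∈ M.elements, (M.sidesOf T).card ≤ N) →
      ∀ v : WG.WeakFun d, WG.InV0 k Ω M v →
        α₁ * WG.tripleNorm k M v ^ 2 ≤ WG.bilinA k μ M v v ∧
          WG.bilinA k μ M v v ≤ α₂ * WG.tripleNorm k M v ^ 2 := by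
  have hd1 : 1 ≤ d := by omega
  obtain ⟨K, hK, hKv⟩ := WG.exists_strain_sub_le d k hd1 c N
  -- With `E`, `W`, `J` the squared strain, weak strain and weighted jump on `T`: `E ≤ 2W + 2KJ`
  -- gives `E + J ≤ 2W + (2K + 1)J`, to be compared with `2μW + J`. Conversely `W ≤ 2E + 2KJ` gives
  -- `2μW + J ≤ 4μE + (4μK + 1)J`.
  refine ⟨min μ (1 / (2 * K + 1)), 4 * μ + 4 * μ * K + 1, lt_min hμ (by positivity), by positivity,
    fun Ω _ _ _ _ M hM hreg hN v hv => ?_⟩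
  have hJ0 : ∀ T ∈ M.elements, 0 ≤ (WG.size T)⁻¹ *
      ∑ e ∈ M.sidesOf T, WG.ipSide e (WG.jump k v T e) (WG.jump k v T e) := fun T _ =>
    mul_nonneg (inv_nonneg.2 Metric.diam_nonneg)
      (Finset.sum_nonneg fun e _ => WG.ipSide_self_nonneg _ _)
  have hnorm : WG.tripleNorm k M v ^ 2 = ∑ T ∈ M.elements,
      (WG.ipElem T (WG.strain (v.inn T)) (WG.strain (v.inn T)) +
        (WG.size T)⁻¹ * ∑ e ∈ M.sidesOf T, WG.ipSide e (WG.jump k v T e) (WG.jump k v T e)) :=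
    Real.sq_sqrt (Finset.sum_nonneg fun T hT =>
      add_nonneg (WG.ipElem_self_nonneg _ _) (hJ0 T hT))
  have hbil : WG.bilinA k μ M v v = ∑ T ∈ M.elements,
      (2 * μ * WG.ipElem T (WG.weakStrain (k - 1) M v T) (WG.weakStrain (k - 1) M v T) +
        (WG.size T)⁻¹ * ∑ e ∈ M.sidesOf T, WG.ipSide e (WG.jump k v T e) (WG.jump k v T e)) := by
    rw [WG.bilinA, WG.stab, Finset.mul_sum, ← Finset.sum_add_distrib]
    refine Finset.sum_congr rfl fun T _ => ?_
    congr 1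
    simp only [WG.ipElem, WG.frob_smul_left, integral_const_mul]
    ring
  rw [hnorm, hbil, Finset.mul_sum, Finset.mul_sum]
  have hT : ∀ T ∈ M.elements, _ := fun T hT => hKv Ω M hM hreg T hT (hN T hT) v hv.1
  have hloc : ∀ T ∈ M.elements,
      WG.ipElem T (WG.weakStrain (k - 1) M v T) (WG.weakStrain (k - 1) M v T) ≤
        2 * WG.ipElem T (WG.strain (v.inn T)) (WG.strain (v.inn T)) + 2 * (K * ((WG.size T)⁻¹ *
          ∑ e ∈ M.sidesOf T, WG.ipSide e (WG.jump k v T e) (WG.jump k v T e))) ∧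
      WG.ipElem T (WG.strain (v.inn T)) (WG.strain (v.inn T)) ≤
        2 * WG.ipElem T (WG.weakStrain (k - 1) M v T) (WG.weakStrain (k - 1) M v T) +
          2 * (K * ((WG.size T)⁻¹ *
            ∑ e ∈ M.sidesOf T, WG.ipSide e (WG.jump k v T e) (WG.jump k v T e))) := fun T hTm => by
    obtain ⟨hW, hle⟩ := hT T hTm
    have hc := (hM.elements_polytope T hTm).compact
    have hE : WG.ContMat (WG.strain (v.inn T)) := by
      simp only [funext (WG.strain_eq (v.inn T))]
      exact (hv.1.1 T hTm).grad.symm.contMat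
    have hle' : WG.ipElem T (fun x => WG.strain (v.inn T) x - WG.weakStrain (k - 1) M v T x)
        (fun x => WG.strain (v.inn T) x - WG.weakStrain (k - 1) M v T x) = WG.ipElem T
        (fun x => WG.weakStrain (k - 1) M v T x - WG.strain (v.inn T) x)
        (fun x => WG.weakStrain (k - 1) M v T x - WG.strain (v.inn T) x) := by
      simp only [WG.ipElem, WG.frob, Matrix.sub_apply]
      congr 1; ext x
      refine Finset.sum_congr rfl fun i _ => Finset.sum_congr rfl fun j _ => ?_
      ring
    have h1 := WG.ipElem_self_le hc hW hE
    have h2 := WG.ipElem_self_le hc hE hW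
    rw [hle'] at h2
    exact ⟨by linarith, by linarith⟩
  refine ⟨Finset.sum_le_sum fun T hTm => ?_, Finset.sum_le_sum fun T hTm => ?_⟩
  · have h1 := (hloc T hTm).2
    have hJ := hJ0 T hTm
    have hW := WG.ipElem_self_nonneg T (WG.weakStrain (k - 1) M v T)
    set J := (WG.size T)⁻¹ *
      ∑ e ∈ M.sidesOf T, WG.ipSide e (WG.jump k v T e) (WG.jump k v T e)
    set W := WG.ipElem T (WG.weakStrain (k - 1) M v T) (WG.weakStrain (k - 1) M v T)
    have hα : 0 ≤ min μ (1 / (2 * K + 1)) := le_min hμ.le (by positivity)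
    calc _ ≤ min μ (1 / (2 * K + 1)) * (2 * W + (2 * K + 1) * J) :=
          mul_le_mul_of_nonneg_left (by linarith) hα
      _ = min μ (1 / (2 * K + 1)) * (2 * W) + min μ (1 / (2 * K + 1)) * ((2 * K + 1) * J) := by ring
      _ ≤ μ * (2 * W) + 1 / (2 * K + 1) * ((2 * K + 1) * J) := by
          gcongr
          · exact min_le_left _ _
          · exact min_le_right _ _
      _ = 2 * μ * W + J := by field_simp
  · have h1 := (hloc T hTm).1
    have hJ := hJ0 T hTm
    have hE := WG.ipElem_self_nonneg T (WG.strain (v.inn T))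
    set J := (WG.size T)⁻¹ *
      ∑ e ∈ M.sidesOf T, WG.ipSide e (WG.jump k v T e) (WG.jump k v T e)
    set E := WG.ipElem T (WG.strain (v.inn T)) (WG.strain (v.inn T))
    have h2 := mul_le_mul_of_nonneg_left h1 (show 0 ≤ 2 * μ by positivity)
    have h3 : 0 ≤ 4 * μ * K * E := by positivity
    have h4 : 0 ≤ 4 * μ * J := by positivity
    linarith [h2, h3, h4, hE, hJ]
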